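/- **Notation.** For $\delta\in\mathbb R$ let $\mathbb H_\delta=\{s\in\mathbb C:\operatorname{Re}s>\delta\}$. Let $H^\infty_1(\mathbb H_0)$ be the set of holomorphic functions on $\mathbb H_0$ bounded by $1$ in modulus, and let $\mathcal D$ be the set of functions representable by a convergent Dirichlet series $\sum_{n\ge1}c_nn^{-s}$ in some right half-plane. Inner products are linear in the first variable. On $\mathbb H_{1/2}$ consider the positive semi-definite kernels $$\varkappa(s,u)=\zeta(s+\overline u),\qquad \kappa_\mu(s,u)=\sum_{m=1}^\infty(1+\mu(m))\,m^{-s-\overline u},$$ where $\zeta$ is the Riemann zeta function and $\mu$ the Möbius function. Let $\mathscr H^2$ and $\mathscr H_\mu$ be the associated reproducing kernel Hilbert spaces of functions on $\mathbb H_{1/2}$, and write $\varkappa_u=\varkappa(\cdot,u)\in\mathscr H^2$, $\kappa_{\mu,u}=\kappa_\mu(\cdot,u)\in\mathscr H_\mu$. Tensor products are Hilbert space tensor products and direct sums are orthogonal. For a function $\varphi:\mathbb H_0\to\mathbb C$ consider the following condition. **(ii)** There exist a Hilbert space $\mathscr K$, a holomorphic function $\psi:\mathbb H_{1/2}\to\mathscr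 K$, $a\in\mathbb C$, $\beta\in\mathscr H^2\otimes\mathscr K$, $\gamma\in\mathscr H_\mu\otimes\mathscr K$ and a bounded linear map $D:\mathscr H^2\otimes\mathscr K\to\mathscr H_\mu\otimes\mathscr K$ such that: * the block operator $$V=\begin{bmatrix}a&1\otimes\beta\\ \gamma\otimes1&D\end{bmatrix}:\mathbb C\oplus(\mathscr H^2\otimes\mathscr K)\to\mathbb C\oplus(\mathscr H_\mu\otimes\mathscr K),\qquad V(c\oplus x)=(ac+\langle x,\beta\rangle)\oplus(c\gamma+Dx),$$ is a contraction, and it is isometric on the closed linear span of $\{1\oplus(\varkappa_{\overline s}\otimes\psi(s)):s\in\mathbb H_{1/2}\}$; * $D(\varkappa_{\overline s}\otimes\psi(s))=\kappa_{\mu,\overline s}\otimes\psi(s)-\gamma$ for every $s\in\mathbb H_{1/2}$; * for every $s\in\mathbb H_{1/2}$ there is a bounded linear map $T_{\overline s}:\mathscr H^2\to\mathscr H_\mu$ with $T_{\overline s}\varkappa_{\overline s}=\kappa_{\mu,\overline s}$ such that $T_{\overline s}\otimes I-D$ is invertible with bounded inverse and $$\varphi(s)=a+\big\langle(T_{\overline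 s}\otimes I-D)^{-1}\gamma,\beta\big\rangle_{\mathscr H^2\otimes\mathscr K}.$$ **Theorem (network realization formula).** Let $\varphi:\mathbb H_0\to\mathbb C$ be a function. 1. The restriction $\varphi|_{\mathbb H_{1/2}}$ is the restriction to $\mathbb H_{1/2}$ of some function in $H^\infty_1(\mathbb H_0)\cap\mathcal D$ if and only if (ii) holds. 2. If $\varphi$ is holomorphic on $\mathbb H_0$, then $\varphi\in H^\infty_1(\mathbb H_0)\cap\mathcal D$ if and only if (ii) holds. -/

import Mathlib

open scoped ComplexConjugate TensorProduct InnerProductSpace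

universe u

noncomputable section

namespace NetworkRealization

/-- The open right half-plane `ℍ_δ = {s : δ < Re s}`. -/
def halfPlane (δ : ℝ) : Set ℂ := {s | δ < s.re}

/-- Complex conjugation on `ℍ_δ`. -/
def conjPt {δ : ℝ} (s : halfPlane δ) : halfPlane δ :=
  ⟨conj (s : ℂ), by
    have h := s.2
    simpa [halfPlane] using h⟩

/-- `φ` (restricted to `ℍ_0`) lies in the closed unit ball of `H^∞(ℍ_0)`. -/
def MemUnitBallHInfty (φ : ℂ → ℂ) : Prop :=
  DifferentiableOn ℂ φ (halfPlane 0) ∧ ∀ s ∈ halfPlane 0, ‖φ s‖ ≤ 1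

/-- The function `φ` on `ℍ_0` is the sum of a (possibly conditionally) convergent Dirichlet series
`∑_{n ≥ 1} c n * n ^ (-s)` in some right half-plane `ℍ_σ`, `σ ≥ 0`. -/
def IsDirichletSeries (φ : ℂ → ℂ) : Prop :=
  ∃ (c : ℕ → ℂ) (σ : ℝ), 0 ≤ σ ∧ ∀ s ∈ halfPlane σ,
    Filter.Tendsto (fun N : ℕ => ∑ n ∈ Finset.Icc 1 N, c n * (n : ℂ) ^ (-s))
      Filter.atTop (nhds (φ s))

/-! ### The two kernels and their reproducing kernel Hilbert spaces -/

/-- The Szegő–Dirichlet kernel `ϰ(s, u) = ζ(s + ū)` on `ℍ_{1/2}`. -/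
def szegoKernel (s u : halfPlane (1 / 2)) : ℂ := riemannZeta ((s : ℂ) + conj (u : ℂ))

/-- The kernel `κ_μ(s, u) = ∑_{m ≥ 1} (1 + μ(m)) m ^ (-s - ū)` on `ℍ_{1/2}`, with `m = n + 1`. -/
def muKernel (s u : halfPlane (1 / 2)) : ℂ :=
  ∑' n : ℕ, (1 + (ArithmeticFunction.moebius (n + 1) : ℂ)) *
    ((n + 1 : ℕ) : ℂ) ^ (-(s : ℂ) - conj (u : ℂ))

/-- A scalar kernel, as a matrix of operators on the one-dimensional space `ℂ`. -/
def kernelMatrix {X : Type*} (k : X → X → ℂ) : Matrix X X (ℂ →L[ℂ] ℂ) :=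
  Matrix.of fun s u => k s u • ContinuousLinearMap.id ℂ ℂ

lemma kernelMatrix_apply {X : Type*} (k : X → X → ℂ) (s u : X) (z : ℂ) :
    kernelMatrix k s u z = k s u * z := rfl

lemma posSemidef_kernelMatrix {X : Type*} {k : X → X → ℂ} (w : ℕ → ℝ) (hw : ∀ n, 0 ≤ w n)
    (g : ℕ → X → ℂ) (h : ∀ s u, HasSum (fun n => (w n : ℂ) * (g n s * conj (g n u))) (k s u)) :
    (kernelMatrix k).PosSemidef := by
  have hsymm : ∀ s u, conj (k u s) = k s u := by
    intro s u
    have h1 := (Complex.hasSum_conj'.2 (h u s))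
    refine h1.unique ?_
    convert h s u using 2 with n
    simp only [map_mul, Complex.conj_ofReal, Complex.conj_conj]
    ring
  have hherm : (kernelMatrix k).IsHermitian := by
    have h1 : star (ContinuousLinearMap.id ℂ ℂ) = ContinuousLinearMap.id ℂ ℂ := star_one _
    ext s u
    simp [kernelMatrix, h1, Matrix.conjTranspose_apply, hsymm, star_smul]
  have htfae := (RKHS.posSemidef_tfae (K := kernelMatrix k)).out 0 2
  refine htfae.2 ⟨hherm, fun v => ?_⟩
  have hs : HasSum (fun n => v.sum fun x z => v.sum fun x' z' =>
      (w n : ℂ) * (g n x * conj (g n x') * (conj z * z')) )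
      (v.sum fun x z => v.sum fun x' z' => ⟪kernelMatrix k x' x z, z'⟫_ℂ) := by
    simp only [Finsupp.sum]
    refine hasSum_sum fun x _ => hasSum_sum fun x' _ => ?_
    have := (h x x').mul_right (conj (v x) * v x')
    have e : ⟪kernelMatrix k x' x (v x), v x'⟫_ℂ = k x x' * (conj (v x) * v x') := by
      rw [kernelMatrix_apply, RCLike.inner_apply, map_mul, hsymm]
      ring
    rw [e]
    simpa only [mul_assoc] using this
  have hre := Complex.hasSum_re hs
  refine hre.nonneg fun n => ?_
  have : (v.sum fun x z => v.sum fun x' z' =>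
      (w n : ℂ) * (g n x * conj (g n x') * (conj z * z'))) =
      (w n : ℂ) * ((v.sum fun x z => g n x * conj z) * conj (v.sum fun x z => g n x * conj z)) := by
    simp only [Finsupp.sum, map_sum, map_mul, Complex.conj_conj]
    rw [Finset.sum_mul_sum, Finset.mul_sum]
    simp only [Finset.mul_sum]
    refine Finset.sum_congr rfl fun x _ => Finset.sum_congr rfl fun x' _ => ?_
    ring
  rw [this, Complex.mul_conj, ← Complex.ofReal_mul, Complex.ofReal_re]
  exact mul_nonneg (hw n) (Complex.normSq_nonneg _)

lemma natCast_cpow_neg_sub (n : ℕ) (s u : ℂ) :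
    ((n + 1 : ℕ) : ℂ) ^ (-s - conj u) =
      ((n + 1 : ℕ) : ℂ) ^ (-s) * conj (((n + 1 : ℕ) : ℂ) ^ (-u)) := by
  have h0 : ((n + 1 : ℕ) : ℂ) ≠ 0 := Nat.cast_ne_zero.2 n.succ_ne_zero
  have hc : conj (((n + 1 : ℕ) : ℂ) ^ (-u)) = ((n + 1 : ℕ) : ℂ) ^ (-(conj u)) := by
    rw [← map_neg, Complex.cpow_conj _ _ (by rw [Complex.natCast_arg]; exact Real.pi_pos.ne),
      Complex.conj_natCast]
  rw [hc, ← Complex.cpow_add _ _ h0, sub_eq_add_neg]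

lemma summable_natCast_cpow (s u : halfPlane (1 / 2)) :
    Summable fun n : ℕ => ((n + 1 : ℕ) : ℂ) ^ (-(s : ℂ) - conj (u : ℂ)) := by
  have hs : 1 / 2 < (s : ℂ).re := s.2
  have hu : 1 / 2 < (u : ℂ).re := u.2
  have h : 1 < ((s : ℂ) + conj (u : ℂ)).re := by
    simp only [Complex.add_re, Complex.conj_re]; linarith
  have h2 := (summable_nat_add_iff 1).2 (Complex.summable_one_div_nat_cpow.2 h)
  refine h2.congr fun n => ?_
  rw [show -(s : ℂ) - conj (u : ℂ) = -((s : ℂ) + conj (u : ℂ)) by ring, Complex.cpow_neg, one_div]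

lemma hasSum_szegoKernel (s u : halfPlane (1 / 2)) :
    HasSum (fun n : ℕ => ((n + 1 : ℕ) : ℂ) ^ (-(s : ℂ) - conj (u : ℂ))) (szegoKernel s u) := by
  have hs : 1 / 2 < (s : ℂ).re := s.2
  have hu : 1 / 2 < (u : ℂ).re := u.2
  have h : 1 < ((s : ℂ) + conj (u : ℂ)).re := by
    simp only [Complex.add_re, Complex.conj_re]; linarith
  convert (summable_natCast_cpow s u).hasSum using 1
  rw [szegoKernel, zeta_eq_tsum_one_div_nat_add_one_cpow h]
  refine tsum_congr fun n => ?_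
  rw [show -(s : ℂ) - conj (u : ℂ) = -((s : ℂ) + conj (u : ℂ)) by ring, Complex.cpow_neg, one_div]
  push_cast
  rfl

lemma hasSum_muKernel (s u : halfPlane (1 / 2)) :
    HasSum (fun n : ℕ => (1 + (ArithmeticFunction.moebius (n + 1) : ℂ)) *
      ((n + 1 : ℕ) : ℂ) ^ (-(s : ℂ) - conj (u : ℂ))) (muKernel s u) := by
  refine Summable.hasSum ?_
  refine Summable.of_norm_bounded ((summable_natCast_cpow s u).norm.mul_left 2) fun n => ?_
  rw [norm_mul]
  refine mul_le_mul_of_nonneg_right ?_ (norm_nonneg _)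
  have hm : |(ArithmeticFunction.moebius (n + 1))| ≤ 1 := ArithmeticFunction.abs_moebius_le_one
  calc ‖(1 + (ArithmeticFunction.moebius (n + 1) : ℂ))‖
      ≤ ‖(1 : ℂ)‖ + ‖(ArithmeticFunction.moebius (n + 1) : ℂ)‖ := norm_add_le _ _
    _ ≤ 2 := by
      rw [norm_one, Complex.norm_intCast]
      have : |((ArithmeticFunction.moebius (n + 1) : ℤ) : ℝ)| ≤ 1 := by exact_mod_cast hm
      linarith

instance fact_posSemidef_szegoKernel : Fact (kernelMatrix szegoKernel).PosSemidef :=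
  ⟨posSemidef_kernelMatrix (fun _ => 1) (fun _ => zero_le_one)
    (fun n s => ((n + 1 : ℕ) : ℂ) ^ (-(s : ℂ))) fun s u => by
      simpa only [Complex.ofReal_one, one_mul, ← natCast_cpow_neg_sub] using
        hasSum_szegoKernel s u⟩

instance fact_posSemidef_muKernel : Fact (kernelMatrix muKernel).PosSemidef :=
  ⟨posSemidef_kernelMatrix (fun n => 1 + (ArithmeticFunction.moebius (n + 1) : ℝ))
    (fun n => by
      have hm : |(ArithmeticFunction.moebius (n + 1))| ≤ 1 := ArithmeticFunction.abs_moebius_le_one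
      have : (-1 : ℝ) ≤ (ArithmeticFunction.moebius (n + 1) : ℝ) := by
        exact_mod_cast (abs_le.1 hm).1
      linarith)
    (fun n s => ((n + 1 : ℕ) : ℂ) ^ (-(s : ℂ))) fun s u => by
      have h := hasSum_muKernel s u
      simp only [natCast_cpow_neg_sub] at h
      simpa using h⟩

/-- `ℋ²`, the reproducing kernel Hilbert space on `ℍ_{1/2}` with kernel `ϰ`. -/
def HTwo : Type := RKHS.OfKernel (kernelMatrix szegoKernel)

instance : NormedAddCommGroup HTwo :=
  inferInstanceAs (NormedAddCommGroup (RKHS.OfKernel (kernelMatrix szegoKernel)))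
instance : InnerProductSpace ℂ HTwo :=
  inferInstanceAs (InnerProductSpace ℂ (RKHS.OfKernel (kernelMatrix szegoKernel)))
instance : CompleteSpace HTwo :=
  inferInstanceAs (CompleteSpace (RKHS.OfKernel (kernelMatrix szegoKernel)))
instance : RKHS ℂ HTwo (halfPlane (1 / 2)) ℂ :=
  inferInstanceAs (RKHS ℂ (RKHS.OfKernel (kernelMatrix szegoKernel)) (halfPlane (1 / 2)) ℂ)

lemma kernel_HTwo : RKHS.kernel HTwo = kernelMatrix szegoKernel :=
  RKHS.OfKernel.kernel_ofKernel (K := kernelMatrix szegoKernel)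

/-- `ℋ_μ`, the reproducing kernel Hilbert space on `ℍ_{1/2}` with kernel `κ_μ`. -/
def HMu : Type := RKHS.OfKernel (kernelMatrix muKernel)

instance : NormedAddCommGroup HMu :=
  inferInstanceAs (NormedAddCommGroup (RKHS.OfKernel (kernelMatrix muKernel)))
instance : InnerProductSpace ℂ HMu :=
  inferInstanceAs (InnerProductSpace ℂ (RKHS.OfKernel (kernelMatrix muKernel)))
instance : CompleteSpace HMu :=
  inferInstanceAs (CompleteSpace (RKHS.OfKernel (kernelMatrix muKernel)))
instance : RKHS ℂ HMu (halfPlane (1 / 2)) ℂ :=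
  inferInstanceAs (RKHS ℂ (RKHS.OfKernel (kernelMatrix muKernel)) (halfPlane (1 / 2)) ℂ)

lemma kernel_HMu : RKHS.kernel HMu = kernelMatrix muKernel :=
  RKHS.OfKernel.kernel_ofKernel (K := kernelMatrix muKernel)

/-- The kernel function `ϰ_u = ϰ(·, u) ∈ ℋ²`. -/
def szegoFun (u : halfPlane (1 / 2)) : HTwo := RKHS.kerFun HTwo u 1

/-- The kernel function `κ_{μ,u} = κ_μ(·, u) ∈ ℋ_μ`. -/
def muFun (u : halfPlane (1 / 2)) : HMu := RKHS.kerFun HMu u 1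

lemma szegoFun_apply (u s : halfPlane (1 / 2)) : szegoFun u s = szegoKernel s u := by
  rw [szegoFun, RKHS.kerFun_apply, kernel_HTwo, kernelMatrix_apply, mul_one]

lemma muFun_apply (u s : halfPlane (1 / 2)) : muFun u s = muKernel s u := by
  rw [muFun, RKHS.kerFun_apply, kernel_HMu, kernelMatrix_apply, mul_one]

/-! ### Hilbert space tensor products and block operators -/

/-- The Hilbert space tensor product: completion of the algebraic tensor product for the inner
product determined by `⟪x ⊗ y, x' ⊗ y'⟫ = ⟪x, x'⟫ ⟪y, y'⟫`. -/
abbrev HilbertTensor (E F : Type*) [NormedAddCommGroup E] [InnerProductSpace ℂ E]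
    [NormedAddCommGroup F] [InnerProductSpace ℂ F] : Type _ :=
  UniformSpace.Completion (E ⊗[ℂ] F)

section

variable {E F G : Type*} [NormedAddCommGroup E] [InnerProductSpace ℂ E]
  [NormedAddCommGroup F] [InnerProductSpace ℂ F] [NormedAddCommGroup G] [InnerProductSpace ℂ G]

/-- The elementary tensor `x ⊗ y` in the Hilbert space tensor product. -/
def tensor (x : E) (y : F) : HilbertTensor E F := ((x ⊗ₜ[ℂ] y : E ⊗[ℂ] F) : HilbertTensor E F)

/-- `T ⊗ I` on Hilbert space tensor products. -/
def ampliation (G : Type*) [NormedAddCommGroup G] [InnerProductSpace ℂ G] (T : E →L[ℂ] F) :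
    HilbertTensor E G →L[ℂ] HilbertTensor F G :=
  (T.rTensor G).completion

lemma ampliation_tensor (T : E →L[ℂ] F) (x : E) (y : G) :
    ampliation G T (tensor x y) = tensor (T x) y := by
  simp [ampliation, tensor]

lemma inner_tensor (x x' : E) (y y' : F) :
    ⟪tensor x y, tensor x' y'⟫_ℂ = ⟪x, x'⟫_ℂ * ⟪y, y'⟫_ℂ := by
  simp [tensor]

/-- The block operator `[[a, 1 ⊗ β], [γ ⊗ 1, D]] : ℂ ⊕ E → ℂ ⊕ F` between orthogonal direct sums,
`c ⊕ x ↦ (a c + ⟨x, β⟩) ⊕ (c γ + D x)`, where `⟨x, β⟩` is linear in `x`. -/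
def blockOp (a : ℂ) (β : E) (γ : F) (D : E →L[ℂ] F) :
    WithLp 2 (ℂ × E) →L[ℂ] WithLp 2 (ℂ × F) :=
  ((WithLp.prodContinuousLinearEquiv 2 ℂ ℂ F).symm : ℂ × F →L[ℂ] WithLp 2 (ℂ × F)) ∘L
    ((a • ContinuousLinearMap.fst ℂ ℂ E + innerSL ℂ β ∘L ContinuousLinearMap.snd ℂ ℂ E).prod
      ((ContinuousLinearMap.fst ℂ ℂ E).smulRight γ + D ∘L ContinuousLinearMap.snd ℂ ℂ E)) ∘L
    ((WithLp.prodContinuousLinearEquiv 2 ℂ ℂ E) : WithLp 2 (ℂ × E) →L[ℂ] ℂ × E)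

lemma blockOp_toLp (a : ℂ) (β : E) (γ : F) (D : E →L[ℂ] F) (c : ℂ) (x : E) :
    blockOp a β γ D (WithLp.toLp 2 (c, x)) =
      WithLp.toLp 2 (a * c + ⟪β, x⟫_ℂ, c • γ + D x) := by
  simp [blockOp]

end

/-- The data `ψ`, `V = [[a, 1 ⊗ β], [γ ⊗ 1, D]]` on the Hilbert space `K` realize `φ` on
`ℍ_{1/2}`. Mathlib's inner product is linear in its second argument. -/
structure Realizes (φ : ℂ → ℂ) (K : Type*) [NormedAddCommGroup K] [InnerProductSpace ℂ K]
    (ψ : ℂ → K) (a : ℂ) (β : HilbertTensor HTwo K) (γ : HilbertTensor HMu K)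
    (D : HilbertTensor HTwo K →L[ℂ] HilbertTensor HMu K) : Prop where
  holomorphic : DifferentiableOn ℂ ψ (halfPlane (1 / 2))
  contraction : ‖blockOp a β γ D‖ ≤ 1
  isometric : ∀ x ∈ (Submodule.span ℂ (Set.range fun s : halfPlane (1 / 2) =>
      (WithLp.toLp 2 ((1 : ℂ), tensor (szegoFun (conjPt s)) (ψ s)) :
        WithLp 2 (ℂ × HilbertTensor HTwo K)))).topologicalClosure,
    ‖blockOp a β γ D x‖ = ‖x‖
  map_tensor : ∀ s : halfPlane (1 / 2),
    D (tensor (szegoFun (conjPt s)) (ψ s)) = tensor (muFun (conjPt s)) (ψ s) - γ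
  formula : ∀ s : halfPlane (1 / 2), ∃ T : HTwo →L[ℂ] HMu,
    T (szegoFun (conjPt s)) = muFun (conjPt s) ∧ (ampliation K T - D).IsInvertible ∧
      φ s = a + ⟪β, (ampliation K T - D).inverse γ⟫_ℂ

/-- `φ` has a network realization over some Hilbert space (in the universe `u`). -/
def HasNetworkRealization (φ : ℂ → ℂ) : Prop :=
  ∃ (K : Type u) (_ : NormedAddCommGroup K) (_ : InnerProductSpace ℂ K) (_ : CompleteSpace K)
    (ψ : ℂ → K) (a : ℂ) (β : HilbertTensor HTwo K) (γ : HilbertTensor HMu K)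
    (D : HilbertTensor HTwo K →L[ℂ] HilbertTensor HMu K), Realizes φ K ψ a β γ D

end NetworkRealization

end

/-! Everything passes through the contractive multipliers of $\mathscr H^2$. In the model `ell2` the
vector `expVec s` is $e_s=(n^{-s})_n$, and $\langle e_s,e_u\rangle=\zeta(s+\overline u)$. Both
conditions on $\varphi$ amount to having a contraction $N$ with $Ne_s=\varphi(s)e_s$ for
$\operatorname{Re}s>1/2$, or equivalently to $\zeta(s+\overline
u)(1-\varphi(s)\overline{\varphi(u)})$ being a Gram kernel $\langle\psi(s),\psi(u)\rangle$.

Gram kernel and realization. Since $\kappa_\mu-\zeta=1/\zeta$ (`szegoKernel_mul_muKernel_sub`), the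
Gram identity says
$1+\zeta\langle\psi,\psi\rangle=\varphi\overline\varphi+\kappa_\mu\langle\psi,\psi\rangle$. This is
exactly the statement that $1\oplus(\varkappa_{\overline
s}\otimes\psi(s))\mapsto\varphi(s)\oplus(\kappa_{\mu,\overline s}\otimes\psi(s))$ preserves inner
products; extended by zero off the closed span, the map is the block operator $V$. The formula for
$\varphi$ follows because $(T_{\overline s}\otimes I-D)(\varkappa_{\overline
s}\otimes\psi(s))=\gamma$. A suitable $T_{\overline s}$ exists because $\|\varkappa_{\overline
s}\|<\|\kappa_{\mu,\overline s}\|$ and both spaces are unitarily equivalent to $\ell^2$: a unitary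
times a scalar of modulus $>1$ does it, and a Neumann series inverts $T_{\overline s}\otimes I-D$.
See `Realizes.inner_eq` and `exists_realizes_of_inner_eq`.

Bounded Dirichlet series to contraction (`MemUnitBallHInfty.exists_contraction`). Gaussian means of
$\varphi(\varepsilon+it)$ against Dirichlet polynomials recover the matrix $(a_{n/m})$, and
$|\varphi|\le1$ bounds its bilinear form. The defect operator $(1-N^*N)^{1/2}$ applied to $e_s$ then
gives $\psi$.

Contraction to bounded Dirichlet series (`exists_memUnitBall_of_contraction`). Restricted to
integers with prime factors below $k$, the vector $(n^{-s})$ is square summable on all of $\mathbb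
H_0$ and is still an eigenvector of $N$. Its eigenvalue $f_k(s)$ is bounded by $1$ on $\mathbb H_0$
and converges to $\varphi$ on $\mathbb H_{1/2}$; the limit extends to $\mathbb H_0$. -/

noncomputable section

namespace NetworkRealization

/-! ### Hilbert space operators: contractions from Gram data, unitaries, ampliations, blocks -/

section Hilbert

variable {ι E F G : Type*} [NormedAddCommGroup E] [InnerProductSpace ℂ E]
  [NormedAddCommGroup F] [InnerProductSpace ℂ F]
  [NormedAddCommGroup G] [InnerProductSpace ℂ G]

/-- If finite combinations of the `y i` are dominated in norm by those of the `x i`, some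
contraction maps each `x i` to `y i`. -/
theorem exists_contraction_of_norm_le [CompleteSpace E] [CompleteSpace F] (x : ι → E) (y : ι → F)
    (h : ∀ c : ι →₀ ℂ, ‖Finsupp.linearCombination ℂ y c‖ ≤ ‖Finsupp.linearCombination ℂ x c‖) :
    ∃ T : E →L[ℂ] F, ‖T‖ ≤ 1 ∧ ∀ i, T (x i) = y i := by
  classical
  let M : Submodule ℂ E := (LinearMap.range (Finsupp.linearCombination ℂ x)).topologicalClosure
  have hM : ∀ c, Finsupp.linearCombination ℂ x c ∈ M := fun c =>
    Submodule.le_topologicalClosure _ ⟨c, rfl⟩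
  let e : (ι →₀ ℂ) →ₗ[ℂ] M := (Finsupp.linearCombination ℂ x).codRestrict M hM
  have hclosed : IsClosed (M : Set E) := Submodule.isClosed_topologicalClosure _
  have : CompleteSpace M := hclosed.completeSpace_coe
  have hd : DenseRange e := by
    intro z
    have hz : (z : E) ∈ closure (Set.range (Finsupp.linearCombination ℂ x)) := by
      have := z.2
      rwa [← SetLike.mem_coe, Submodule.topologicalClosure_coe] at this
    rw [Topology.IsInducing.subtypeVal.closure_eq_preimage_closure_image]
    rw [Set.mem_preimage, ← Set.range_comp]
    exact hz
  have hn : ∀ c, ‖Finsupp.linearCombination ℂ y c‖ ≤ 1 * ‖e c‖ := fun c => by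
    rw [one_mul]; exact h c
  -- Extension by continuity to the closed span `M`, preceded by the orthogonal projection onto `M`,
  -- so the operator vanishes on the complement of `M`.
  refine ⟨((Finsupp.linearCombination ℂ y).extendOfNorm e) ∘L M.orthogonalProjectionOnto, ?_, ?_⟩
  · refine (ContinuousLinearMap.opNorm_comp_le _ _).trans ?_
    exact mul_le_one₀ (LinearMap.opNorm_extendOfNorm_le hd zero_le_one hn) (norm_nonneg _)
      M.orthogonalProjectionOnto_norm_le
  · intro i
    have hi : M.orthogonalProjectionOnto (x i) = e (Finsupp.single i 1) := by
      have hx : x i = ((e (Finsupp.single i 1) : M) : E) := by simp [e]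
      rw [hx]
      exact Submodule.orthogonalProjectionOnto_mem_subspace_eq_self _
    rw [ContinuousLinearMap.comp_apply, hi, LinearMap.extendOfNorm_eq hd ⟨1, hn⟩]
    simp

lemma norm_linearCombination_eq_of_inner_eq {x : ι → E} {y : ι → F}
    (h : ∀ i j, ⟪x i, x j⟫_ℂ = ⟪y i, y j⟫_ℂ) (c : ι →₀ ℂ) :
    ‖Finsupp.linearCombination ℂ y c‖ = ‖Finsupp.linearCombination ℂ x c‖ := by
  have : ⟪Finsupp.linearCombination ℂ y c, Finsupp.linearCombination ℂ y c⟫_ℂ =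
      ⟪Finsupp.linearCombination ℂ x c, Finsupp.linearCombination ℂ x c⟫_ℂ := by
    simp only [Finsupp.linearCombination_apply, Finsupp.sum, sum_inner, inner_sum,
      inner_smul_left, inner_smul_right, h]
  rw [@norm_eq_sqrt_re_inner ℂ, @norm_eq_sqrt_re_inner ℂ, this]

/-- Total families with the same Gram matrix are related by a unitary. -/
theorem exists_linearIsometryEquiv_of_inner_eq [CompleteSpace E] [CompleteSpace F]
    (x : ι → E) (y : ι → F)
    (hx : Dense (Submodule.span ℂ (Set.range x) : Set E))
    (hy : Dense (Submodule.span ℂ (Set.range y) : Set F))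
    (h : ∀ i j, ⟪x i, x j⟫_ℂ = ⟪y i, y j⟫_ℂ) :
    ∃ U : E ≃ₗᵢ[ℂ] F, ∀ i, U (x i) = y i := by
  obtain ⟨T, hT, hTx⟩ := exists_contraction_of_norm_le x y fun c =>
    (norm_linearCombination_eq_of_inner_eq h c).le
  obtain ⟨S, hS, hSy⟩ := exists_contraction_of_norm_le y x fun c =>
    (norm_linearCombination_eq_of_inner_eq h c).ge
  have hST : S ∘L T = ContinuousLinearMap.id ℂ E := by
    refine ContinuousLinearMap.ext_on hx ?_
    rintro _ ⟨i, rfl⟩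
    simp [hTx, hSy]
  have hTS : T ∘L S = ContinuousLinearMap.id ℂ F := by
    refine ContinuousLinearMap.ext_on hy ?_
    rintro _ ⟨i, rfl⟩
    simp [hTx, hSy]
  have h1 : ∀ z, S (T z) = z := fun z => DFunLike.congr_fun hST z
  have h2 : ∀ z, T (S z) = z := fun z => DFunLike.congr_fun hTS z
  refine ⟨⟨LinearEquiv.ofLinearMap T.toLinearMap S.toLinearMap (LinearMap.ext h2) (LinearMap.ext h1),
    fun z => ?_⟩, hTx⟩
  refine le_antisymm ((T.le_of_opNorm_le hT z).trans (one_mul _).le) ?_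
  have := (S.le_of_opNorm_le hS (T z)).trans (one_mul _).le
  rwa [h1] at this

/-- The reflection exchanging two vectors of equal norm with real inner product. -/
lemma exists_linearIsometryEquiv_apply_eq_of_inner_eq_ofReal {p q : E} (h : ‖p‖ = ‖q‖) {r : ℝ}
    (hr : ⟪q, p⟫_ℂ = r) : ∃ W : E ≃ₗᵢ[ℂ] E, W p = q := by
  rcases eq_or_ne p q with hpq | hpq
  · exact ⟨LinearIsometryEquiv.refl ℂ E, hpq⟩
  have hv : p - q ≠ 0 := sub_ne_zero.2 hpq
  -- Equal norms and a real inner product give $\|p-q\|^2=2\langle p,p-q\rangle$. Hence $p$ projects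
  -- to $(p-q)/2$ on this line, and the reflection fixing the line sends $p$ to $-q$.
  refine ⟨((ℂ ∙ (p - q)).reflection).trans (LinearIsometryEquiv.neg ℂ), ?_⟩
  have hpp : ⟪p, p⟫_ℂ = (‖q‖ : ℂ) ^ 2 := by rw [← h]; exact inner_self_eq_norm_sq_to_K p
  have hqq : ⟪q, q⟫_ℂ = (‖q‖ : ℂ) ^ 2 := inner_self_eq_norm_sq_to_K q
  have hrc : ⟪p, q⟫_ℂ = r := by rw [← inner_conj_symm, hr, Complex.conj_ofReal]
  have h1 : ⟪p - q, p⟫_ℂ = (‖q‖ : ℂ) ^ 2 - r := by rw [inner_sub_left, hpp, hr]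
  have h2 : ((‖p - q‖ : ℂ)) ^ 2 = 2 * ((‖q‖ : ℂ) ^ 2 - r) := by
    have : ((‖p - q‖ : ℂ)) ^ 2 = ⟪p - q, p - q⟫_ℂ := 
      (inner_self_eq_norm_sq_to_K (𝕜 := ℂ) (p - q)).symm
    rw [this, inner_sub_right, h1, inner_sub_left, hrc, hqq]
    ring
  have h3 : ((‖p - q‖ : ℂ)) ^ 2 ≠ 0 := 
    pow_ne_zero 2 (Complex.ofReal_ne_zero.2 (norm_ne_zero_iff.2 hv))
  have h4 : (2 : ℂ) * (⟪p - q, p⟫_ℂ / (‖p - q‖ : ℂ) ^ 2) = 1 := by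
    rw [h1, ← mul_div_assoc, ← h2, div_self h3]
  have h5 : (2 : ℕ) • ((⟪p - q, p⟫_ℂ / ((‖p - q‖ : ℝ) : ℂ) ^ 2) • (p - q)) = p - q := by
    rw [← Nat.cast_smul_eq_nsmul ℂ, smul_smul, Nat.cast_ofNat, h4, one_smul]
  have h6 : (ℂ ∙ (p - q)).reflection p = (p - q) - p :=
    (Submodule.reflection_singleton_apply (𝕜 := ℂ) (p - q) p).trans (congrArg (· - p) h5)
  rw [LinearIsometryEquiv.trans_apply, h6]
  simp

/-- The unitary group acts transitively on spheres. -/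
theorem exists_linearIsometryEquiv_apply_eq {p q : E} (h : ‖p‖ = ‖q‖) :
    ∃ W : E ≃ₗᵢ[ℂ] E, W p = q := by
  -- A unimodular factor `l` rotates `p` until its inner product with `q` is real.
  obtain ⟨l, hl, hlr⟩ : ∃ l : ℂ, ‖l‖ = 1 ∧ l * ⟪q, p⟫_ℂ = (‖⟪q, p⟫_ℂ‖ : ℂ) := by
    rcases eq_or_ne (⟪q, p⟫_ℂ) 0 with h0 | h0
    · exact ⟨1, by simp, by simp [h0]⟩
    · have hn : ‖⟪q, p⟫_ℂ‖ ≠ 0 := norm_ne_zero_iff.2 h0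
      refine ⟨(‖⟪q, p⟫_ℂ‖ : ℂ) / ⟪q, p⟫_ℂ, ?_, by field_simp⟩
      rw [norm_div, Complex.norm_real, norm_norm, div_self hn]
  have hl0 : l ≠ 0 := norm_ne_zero_iff.1 (by rw [hl]; exact one_ne_zero)
  let L : E ≃ₗᵢ[ℂ] E := ⟨LinearEquiv.smulOfNeZero ℂ E l hl0, fun z => by
    change ‖l • z‖ = ‖z‖
    rw [norm_smul, hl, one_mul]⟩
  obtain ⟨W, hW⟩ := exists_linearIsometryEquiv_apply_eq_of_inner_eq_ofReal (p := l • p) (q := q)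
    (by rw [norm_smul, hl, one_mul, h]) (r := ‖⟪q, p⟫_ℂ‖) (by rw [inner_smul_right, hlr])
  exact ⟨L.trans W, hW⟩

/-- If `‖x‖ < ‖y‖`, a scalar multiple of a unitary maps `x` to `y` and has a strictly contractive
inverse. -/
theorem exists_continuousLinearEquiv_apply_eq (U : E ≃ₗᵢ[ℂ] F) {x : E} {y : F} (hx : x ≠ 0)
    (hxy : ‖x‖ < ‖y‖) :
    ∃ T : E ≃L[ℂ] F, T x = y ∧ ‖(T.symm : F →L[ℂ] E)‖ < 1 := by
  have hx0 : 0 < ‖x‖ := norm_pos_iff.2 hx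
  have hy0 : 0 < ‖y‖ := hx0.trans hxy
  have hc : ((‖y‖ / ‖x‖ : ℝ) : ℂ) ≠ 0 := Complex.ofReal_ne_zero.2 (div_pos hy0 hx0).ne'
  obtain ⟨W, hW⟩ := exists_linearIsometryEquiv_apply_eq
    (p := (((‖y‖ / ‖x‖ : ℝ) : ℂ)) • U x) (q := y) (by
      rw [norm_smul, Complex.norm_real, U.norm_map, Real.norm_of_nonneg (by positivity)]
      field_simp)
  refine ⟨(ContinuousLinearEquiv.smulLeft (Units.mk0 _ hc)).trans
    (U.trans W).toContinuousLinearEquiv, ?_, ?_⟩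
  · rw [map_smul] at hW
    refine Eq.trans ?_ hW
    change W (U ((((‖y‖ / ‖x‖ : ℝ) : ℂ)) • x)) = _
    rw [map_smul, map_smul]
  · refine lt_of_le_of_lt (ContinuousLinearMap.opNorm_le_bound _ (M := ‖x‖ / ‖y‖) (by positivity)
      fun z => ?_) ((div_lt_one hy0).2 hxy)
    change ‖(((‖y‖ / ‖x‖ : ℝ) : ℂ))⁻¹ • U.symm (W.symm z)‖ ≤ _
    rw [norm_smul, U.symm.norm_map, W.symm.norm_map, norm_inv, Complex.norm_real,
      Real.norm_of_nonneg (by positivity), inv_div]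

lemma norm_ampliation_le (T : E →L[ℂ] F) : ‖ampliation G T‖ ≤ ‖T‖ := by
  refine ContinuousLinearMap.opNorm_le_bound _ (norm_nonneg _) fun x => ?_
  induction x using UniformSpace.Completion.induction_on with
  | hp => exact isClosed_le (by fun_prop) (by fun_prop)
  | ih x =>
    have : ampliation G T (x : HilbertTensor E G) = ((T.rTensor G x : F ⊗[ℂ] G) :
        HilbertTensor F G) := by simp [ampliation]
    rw [this, UniformSpace.Completion.norm_coe, UniformSpace.Completion.norm_coe]
    exact (T.rTensor G).le_of_opNorm_le (ContinuousLinearMap.norm_rTensor_le _ T) x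

lemma ampliation_symm_apply (T : E ≃L[ℂ] F) (x : HilbertTensor E G) :
    ampliation G (T.symm : F →L[ℂ] E) (ampliation G (T : E →L[ℂ] F) x) = x := by
  induction x using UniformSpace.Completion.induction_on with
  | hp => exact isClosed_eq (by fun_prop) (by fun_prop)
  | ih x =>
    simp only [ampliation, ContinuousLinearMap.completion_apply_coe]
    congr 1
    induction x using TensorProduct.induction_on with
    | zero => simp
    | tmul a b => simp
    | add a b ha hb => rw [map_add, map_add, ha, hb]

/-- `T ⊗ I - D` is invertible when `D` is a contraction and `T⁻¹` a strict contraction. -/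
theorem isInvertible_ampliation_sub (T : E ≃L[ℂ] F) (hT : ‖(T.symm : F →L[ℂ] E)‖ < 1)
    (D : HilbertTensor E G →L[ℂ] HilbertTensor F G) (hD : ‖D‖ ≤ 1) :
    (ampliation G (T : E →L[ℂ] F) - D).IsInvertible := by
  let A : HilbertTensor E G ≃L[ℂ] HilbertTensor F G :=
    ContinuousLinearEquiv.equivOfInverse (ampliation G (T : E →L[ℂ] F))
      (ampliation G (T.symm : F →L[ℂ] E)) (ampliation_symm_apply T) fun x => by
        simpa using ampliation_symm_apply T.symm x
  -- $T\otimes I-D=A(1-A^{-1}D)$ with $A=T\otimes I$, and the second factor is invertible by a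
  -- Neumann series.
  have hlt : ‖(A.symm : HilbertTensor F G →L[ℂ] HilbertTensor E G) ∘L D‖ < 1 := by
    refine lt_of_le_of_lt (ContinuousLinearMap.opNorm_comp_le _ _) ?_
    calc _ ≤ ‖(T.symm : F →L[ℂ] E)‖ * 1 :=
          mul_le_mul (norm_ampliation_le _) hD (ContinuousLinearMap.opNorm_nonneg _)
            (ContinuousLinearMap.opNorm_nonneg _)
      _ < 1 := by rwa [mul_one]
  let B : HilbertTensor E G ≃L[ℂ] HilbertTensor E G := ContinuousLinearEquiv.ofUnit
    (Units.oneSub ((A.symm : HilbertTensor F G →L[ℂ] HilbertTensor E G) ∘L D) hlt)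
  refine ⟨B.trans A, ?_⟩
  ext1 x
  have : B x = x - A.symm (D x) := rfl
  have h2 : ampliation G (T : E →L[ℂ] F) x = A x := rfl
  simp [this, h2]

/-- Every bounded operator between orthogonal sums `ℂ ⊕ E` and `ℂ ⊕ F` is a block operator. -/
theorem exists_blockOp_eq [CompleteSpace E]
    (V : WithLp 2 (ℂ × E) →L[ℂ] WithLp 2 (ℂ × F)) :
    ∃ a β γ D, V = blockOp a β γ D := by
  let iE := (WithLp.prodContinuousLinearEquiv 2 ℂ ℂ E)
  let iF := (WithLp.prodContinuousLinearEquiv 2 ℂ ℂ F)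
  let V' : ℂ × E →L[ℂ] ℂ × F := iF ∘L V ∘L iE.symm
  let f : E →L[ℂ] ℂ := ContinuousLinearMap.fst ℂ ℂ F ∘L V' ∘L ContinuousLinearMap.inr ℂ ℂ E
  refine ⟨(V' (1, 0)).1, (InnerProductSpace.toDual ℂ E).symm f, (V' (1, 0)).2,
    ContinuousLinearMap.snd ℂ ℂ F ∘L V' ∘L ContinuousLinearMap.inr ℂ ℂ E, ?_⟩
  ext1 z
  obtain ⟨c, x, rfl⟩ : ∃ c x, z = WithLp.toLp 2 (c, x) := ⟨z.fst, z.snd, rfl⟩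
  rw [blockOp_toLp, InnerProductSpace.toDual_symm_apply]
  have h1 : V (WithLp.toLp 2 (c, x)) = WithLp.toLp 2 (V' (c, x)) := rfl
  have h2 : V' (c, x) = c • V' (1, 0) + V' (0, x) := by
    rw [← map_smul, ← map_add]; simp
  rw [h1, h2]
  refine congrArg (WithLp.toLp 2) (Prod.ext ?_ ?_)
  · simp [f, mul_comm]
  · simp

lemma norm_corner_le_norm_blockOp (a : ℂ) (β : E) (γ : F) (D : E →L[ℂ] F) :
    ‖D‖ ≤ ‖blockOp a β γ D‖ := by
  refine ContinuousLinearMap.opNorm_le_bound _ (ContinuousLinearMap.opNorm_nonneg _) fun x => ?_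
  have h := (blockOp a β γ D).le_opNorm (WithLp.toLp 2 (0, x))
  rw [blockOp_toLp, WithLp.norm_toLp_snd] at h
  refine le_trans ?_ h
  rw [WithLp.prod_norm_eq_of_L2]
  refine Real.le_sqrt_of_sq_le ?_
  simp

end Hilbert

/-! ### Dirichlet vectors in `ℓ²` -/

/-- The Hilbert space of square summable sequences indexed by the positive integers. -/
abbrev ell2 : Type := lp (fun _ : ℕ+ => ℂ) 2

lemma ell2_hasSum_sq (x : ell2) : HasSum (fun n => ‖x n‖ ^ 2) (‖x‖ ^ 2) := by
  simpa using lp.hasSum_norm (by simp) x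

lemma ell2_hasSum_inner (x y : ell2) : HasSum (fun n => conj (x n) * y n) ⟪x, y⟫_ℂ := by
  have h := lp.hasSum_inner (𝕜 := ℂ) x y
  simpa only [RCLike.inner_apply'] using h

lemma norm_apply_le_ell2 (x : ell2) (n : ℕ+) : ‖x n‖ ≤ ‖x‖ := by
  exact lp.norm_apply_le_norm (by simp) x n

/-- The `n`-th coordinate functional on `ℓ²`. -/
def coord (n : ℕ+) : ell2 →L[ℂ] ℂ := innerSL ℂ (lp.single 2 n (1 : ℂ))

@[simp] lemma coord_apply (n : ℕ+) (x : ell2) : coord n x = x n := by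
  rw [coord, innerSL_apply_apply, lp.inner_single_left]
  simp

lemma halfPlane_isOpen (δ : ℝ) : IsOpen (halfPlane δ) :=
  isOpen_lt continuous_const Complex.continuous_re

lemma halfPlane_isPreconnected (δ : ℝ) : IsPreconnected (halfPlane δ) :=
  (convex_halfSpace_re_gt δ).isPreconnected

lemma halfPlane_anti {δ δ' : ℝ} (h : δ ≤ δ') : halfPlane δ' ⊆ halfPlane δ :=
  fun _ hs => lt_of_le_of_lt h hs

/-- Two holomorphic functions on a half-plane agreeing far to the right are equal. -/
lemma eqOn_halfPlane_of_eqOn {F : Type*} [NormedAddCommGroup F] [NormedSpace ℂ F]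
    [CompleteSpace F] {f g : ℂ → F} {δ σ : ℝ}
    (hf : DifferentiableOn ℂ f (halfPlane δ)) (hg : DifferentiableOn ℂ g (halfPlane δ))
    (h : Set.EqOn f g (halfPlane σ)) : Set.EqOn f g (halfPlane δ) := by
  have hz : ((max δ σ + 1 : ℝ) : ℂ) ∈ halfPlane δ :=
    lt_of_le_of_lt (le_max_left δ σ) (by simp)
  have hz' : ((max δ σ + 1 : ℝ) : ℂ) ∈ halfPlane σ :=
    lt_of_le_of_lt (le_max_right δ σ) (by simp)
  refine (hf.analyticOnNhd (halfPlane_isOpen δ)).eqOn_of_preconnected_of_eventuallyEq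
    (hg.analyticOnNhd (halfPlane_isOpen δ)) (halfPlane_isPreconnected δ) hz ?_
  filter_upwards [(halfPlane_isOpen σ).mem_nhds hz'] with z hz using h hz

/-- The sequence `n ↦ n ^ (-s)` restricted to the index set `S`. -/
def dirCoeff (S : Set ℕ+) (s : ℂ) : ℕ+ → ℂ := S.indicator fun n => ((n : ℕ) : ℂ) ^ (-s)

lemma norm_pnat_cpow (n : ℕ+) (s : ℂ) : ‖((n : ℕ) : ℂ) ^ (-s)‖ = ((n : ℕ) : ℝ) ^ (-s.re) := by
  rw [Complex.norm_natCast_cpow_of_pos n.pos, Complex.neg_re]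

lemma norm_dirCoeff_le {S S' : Set ℕ+} (h : S ⊆ S') {s s' : ℂ} (hs : s'.re ≤ s.re) (n : ℕ+) :
    ‖dirCoeff S s n‖ ≤ ‖dirCoeff S' s' n‖ := by
  by_cases hn : n ∈ S
  · rw [dirCoeff, dirCoeff, Set.indicator_of_mem hn, Set.indicator_of_mem (h hn), norm_pnat_cpow,
      norm_pnat_cpow]
    exact Real.rpow_le_rpow_of_exponent_le (by exact_mod_cast n.pos) (by linarith)
  · rw [dirCoeff, Set.indicator_of_notMem hn, norm_zero]
    exact norm_nonneg _

/-- `∑_{n ∈ S} n ^ (-2σ)` converges for every `σ > δ`. -/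
def SqSummable (S : Set ℕ+) (δ : ℝ) : Prop :=
  ∀ σ : ℝ, δ < σ → Summable fun n => ‖dirCoeff S (σ : ℂ) n‖ ^ 2

lemma SqSummable.mono {S S' : Set ℕ+} {δ : ℝ} (h : SqSummable S' δ) (hS : S ⊆ S') :
    SqSummable S δ := fun σ hσ =>
  (h σ hσ).of_nonneg_of_le (fun _ => sq_nonneg _) fun n =>
    pow_le_pow_left₀ (norm_nonneg _) (norm_dirCoeff_le hS le_rfl n) 2

lemma SqSummable.memℓp {S : Set ℕ+} {δ : ℝ} (h : SqSummable S δ) {s : ℂ} (hs : s ∈ halfPlane δ) :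
    Memℓp (dirCoeff S s) 2 := by
  refine (memℓp_gen_iff (by simp)).2 ?_
  simpa using (h s.re hs).of_nonneg_of_le (fun _ => sq_nonneg _) fun n =>
    pow_le_pow_left₀ (norm_nonneg _) (norm_dirCoeff_le subset_rfl (by simp) n) 2

open Classical in
/-- The vector `(n ^ (-s))_{n ∈ S}` of `ℓ²`, zero if it is not square summable. -/
def dirVec (S : Set ℕ+) (s : ℂ) : ell2 :=
  if h : Memℓp (dirCoeff S s) 2 then ⟨dirCoeff S s, h⟩ else 0

lemma SqSummable.dirVec_apply {S : Set ℕ+} {δ : ℝ} (h : SqSummable S δ) {s : ℂ}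
    (hs : s ∈ halfPlane δ) (n : ℕ+) : dirVec S s n = dirCoeff S s n := by
  rw [dirVec, dif_pos (h.memℓp hs)]

lemma dirCoeff_sub_inter (S A : Set ℕ+) (s : ℂ) (n : ℕ+) :
    dirCoeff S s n - dirCoeff (S ∩ A) s n = dirCoeff (S \ A) s n := by
  by_cases h : n ∈ S <;> by_cases h' : n ∈ A <;> simp [dirCoeff, h, h']

/-- On $\operatorname{Re}s>\sigma$ the squared error is at most $\sum_{n\in S\setminus
A_i}n^{-2\sigma}$, which tends to $0$ by dominated convergence. Used with finite sets to prove
holomorphy and with smooth numbers to approximate `expVec`. -/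
theorem SqSummable.tendstoLocallyUniformlyOn {ι : Type*} {l : Filter ι} {A : ι → Set ℕ+}
    {S : Set ℕ+} {δ : ℝ} (h : SqSummable S δ) (hA : ∀ n ∈ S, ∀ᶠ i in l, n ∈ A i) :
    TendstoLocallyUniformlyOn (fun i => dirVec (S ∩ A i)) (dirVec S) l (halfPlane δ) := by
  rw [Metric.tendstoLocallyUniformlyOn_iff]
  intro ε hε x hx
  obtain ⟨σ, hσ, hσx⟩ := exists_between (show δ < x.re from hx)
  refine ⟨halfPlane σ, mem_nhdsWithin_of_mem_nhds ((halfPlane_isOpen σ).mem_nhds hσx), ?_⟩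
  have hlim : Filter.Tendsto (fun i => ∑' n, ‖dirCoeff (S \ A i) (σ : ℂ) n‖ ^ 2) l (nhds 0) := by
    rw [← tsum_zero (α := ℝ) (β := ℕ+)]
    refine tendsto_tsum_of_dominated_convergence (h σ hσ) (fun n => ?_)
      (Filter.Eventually.of_forall fun i n => ?_)
    · by_cases hn : n ∈ S
      · refine tendsto_const_nhds.congr' ?_
        filter_upwards [hA n hn] with i hi
        simp [dirCoeff, hi]
      · simpa [dirCoeff, hn] using tendsto_const_nhds
    · rw [Real.norm_of_nonneg (sq_nonneg _)]
      exact pow_le_pow_left₀ (norm_nonneg _) (norm_dirCoeff_le Set.sdiff_subset le_rfl n) 2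
  filter_upwards [hlim.eventually_lt_const (show (0 : ℝ) < ε ^ 2 by positivity)] with i hi y hy
  have hy' : y ∈ halfPlane δ := halfPlane_anti hσ.le hy
  rw [dist_eq_norm]
  refine lt_of_pow_lt_pow_left₀ 2 hε.le (lt_of_le_of_lt ?_ hi)
  refine (ell2_hasSum_sq _).tsum_eq.symm.le.trans ?_
  have e : ∀ n, (dirVec S y - dirVec (S ∩ A i) y : ell2) n = dirCoeff (S \ A i) y n := fun n => by
    rw [lp.coeFn_sub, Pi.sub_apply, h.dirVec_apply hy',
      (h.mono Set.inter_subset_left).dirVec_apply hy', dirCoeff_sub_inter]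
  simp only [e]
  have hd : SqSummable (S \ A i) δ := h.mono Set.sdiff_subset
  have hle : ∀ n, ‖dirCoeff (S \ A i) y n‖ ^ 2 ≤ ‖dirCoeff (S \ A i) (σ : ℂ) n‖ ^ 2 := fun n =>
    pow_le_pow_left₀ (norm_nonneg _) (norm_dirCoeff_le subset_rfl (le_of_lt (show σ < y.re from hy)) n) 2
  exact ((hd σ hσ).of_nonneg_of_le (fun _ => sq_nonneg _) hle).tsum_le_tsum hle (hd σ hσ)

lemma differentiable_natCast_cpow_neg (n : ℕ+) :
    Differentiable ℂ fun s : ℂ => ((n : ℕ) : ℂ) ^ (-s) := fun _ =>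
  (differentiableAt_id.neg).const_cpow (Or.inl (Nat.cast_ne_zero.2 n.ne_zero))

/-- Truncations to finite index sets are finite sums of entire vector functions and converge locally
uniformly. -/
theorem SqSummable.differentiableOn {S : Set ℕ+} {δ : ℝ} (h : SqSummable S δ) :
    DifferentiableOn ℂ (dirVec S) (halfPlane δ) := by
  have hlim := h.tendstoLocallyUniformlyOn (l := Filter.atTop) (A := fun F : Finset ℕ+ => ↑F)
    fun n _ => (Filter.eventually_ge_atTop {n}).mono fun F hF => by
      simpa using hF
  refine hlim.differentiableOn (Filter.Eventually.of_forall fun F => ?_) (halfPlane_isOpen δ)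
  classical
  have e : Set.EqOn (dirVec (S ∩ ↑F)) (fun s => ∑ n ∈ F with n ∈ S,
      (((n : ℕ) : ℂ) ^ (-s)) • (lp.single 2 n (1 : ℂ) : ell2)) (halfPlane δ) := by
    intro s hs
    ext m
    rw [(h.mono Set.inter_subset_left).dirVec_apply hs, lp.coeFn_sum, Finset.sum_apply]
    simp only [lp.coeFn_smul, Pi.smul_apply, lp.single_apply, Pi.single_apply, smul_eq_mul,
      mul_ite, mul_one, mul_zero, Finset.sum_ite_eq, Finset.mem_filter, dirCoeff,
      Set.indicator_apply, Set.mem_inter_iff, Finset.mem_coe]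
    simp only [and_comm]
  refine DifferentiableOn.congr ?_ e
  refine DifferentiableOn.fun_sum fun n _ => ?_
  exact ((differentiable_natCast_cpow_neg n).smul_const _).differentiableOn

lemma sqSummable_univ : SqSummable Set.univ (1 / 2) := by
  intro σ hσ
  have h : Summable fun n : ℕ => ((n : ℝ) ^ (2 * σ))⁻¹ := Real.summable_nat_rpow_inv.2 (by linarith)
  refine (h.comp_injective PNat.coe_injective).congr fun n => ?_
  rw [dirCoeff, Set.indicator_univ, norm_pnat_cpow, ← Real.rpow_natCast, ← Real.rpow_mul (by simp),
    Function.comp_apply, ← Real.rpow_neg (by simp)]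
  congr 1
  simp
  ring

/-- The vector `(n ^ (-s))_n`. -/
abbrev expVec (s : ℂ) : ell2 := dirVec Set.univ s

lemma expVec_apply {s : ℂ} (hs : s ∈ halfPlane (1 / 2)) (n : ℕ+) :
    expVec s n = ((n : ℕ) : ℂ) ^ (-s) := by
  rw [expVec, sqSummable_univ.dirVec_apply hs, dirCoeff, Set.indicator_univ]

lemma conj_pnat_cpow (n : ℕ+) (u : ℂ) :
    conj (((n : ℕ) : ℂ) ^ (-u)) = ((n : ℕ) : ℂ) ^ (-(conj u)) := by
  rw [← map_neg, Complex.cpow_conj _ _ (by rw [Complex.natCast_arg]; exact Real.pi_pos.ne),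
    Complex.conj_natCast]

/-- Reindexing a sum over the positive integers by `n ↦ n + 1`. -/
lemma hasSum_pnat_iff {f : ℕ → ℂ} {a : ℂ} :
    HasSum (fun n : ℕ+ => f n) a ↔ HasSum (fun n : ℕ => f (n + 1)) a := by
  rw [← Equiv.pnatEquivNat.symm.hasSum_iff]
  rfl

lemma inner_expVec (s u : halfPlane (1 / 2)) :
    ⟪expVec u, expVec s⟫_ℂ = szegoKernel s u := by
  refine (ell2_hasSum_inner _ _).unique ?_
  have h := hasSum_szegoKernel s u
  rw [← hasSum_pnat_iff (f := fun n => (n : ℂ) ^ (-(s : ℂ) - conj (u : ℂ)))] at h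
  convert h using 2 with n
  rw [expVec_apply s.2, expVec_apply u.2, conj_pnat_cpow, ← Complex.cpow_add _ _
    (Nat.cast_ne_zero.2 n.ne_zero)]
  congr 1
  ring

/-- A Dirichlet series with bounded coefficients vanishing far to the right is trivial. -/
lemma eq_zero_of_hasSum_zero {c : ℕ+ → ℂ} {C : ℝ} (hc : ∀ n, ‖c n‖ ≤ C)
    (h : ∀ σ : ℝ, 2 < σ → HasSum (fun n : ℕ+ => c n * ((n : ℕ) : ℂ) ^ (-(σ : ℂ))) 0) : c = 0 := by
  let f : ℕ → ℂ := fun n => if hn : 0 < n then c ⟨n, hn⟩ else 0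
  have hf : ∀ n : ℕ+, f n = c n := fun n => dif_pos n.pos
  have hab : LSeries.abscissaOfAbsConv f < ⊤ := by
    refine lt_of_le_of_lt (LSeries.abscissaOfAbsConv_le_of_le_const ⟨C, fun n hn => ?_⟩)
      (EReal.coe_lt_top 1)
    simpa [f, Nat.pos_of_ne_zero hn] using hc ⟨n, Nat.pos_of_ne_zero hn⟩
  have hz : (fun x : ℝ => LSeries f x) =ᶠ[Filter.atTop] 0 := by
    filter_upwards [Filter.eventually_gt_atTop 2] with σ hσ
    have h2 : HasSum (fun n : ℕ+ => LSeries.term f σ n) 0 := by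
      convert h σ hσ using 2 with n
      rw [LSeries.term_of_ne_zero n.ne_zero, hf, Complex.cpow_neg, div_eq_mul_inv]
    exact (((PNat.coe_injective.hasSum_iff (f := LSeries.term f σ) fun n hn => by
      rcases Nat.eq_zero_or_pos n with rfl | hn'
      · simp
      · exact absurd ⟨⟨n, hn'⟩, rfl⟩ hn).1 h2)).tsum_eq
  -- The alternative to vanishing coefficients is a series converging absolutely nowhere, which
  -- `hab` excludes.
  rcases LSeries_eventually_eq_zero_iff'.1 hz with h0 | h0
  · ext n
    rw [← hf]
    exact h0 n n.ne_zero
  · exact absurd h0 hab.ne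

/-- The vectors `(n ^ (-s))_n`, `Re s > 1/2`, are total in `ℓ²`. -/
theorem dense_span_expVec :
    Dense (Submodule.span ℂ (Set.range fun s : halfPlane (1 / 2) => expVec s) : Set ell2) := by
  rw [Submodule.dense_iff_topologicalClosure_eq_top, Submodule.topologicalClosure_eq_top_iff,
    Submodule.eq_bot_iff]
  intro x hx
  rw [Submodule.mem_orthogonal'] at hx
  -- Orthogonality to `expVec σ` makes the Dirichlet series with coefficients $\overline{x_n}$
  -- vanish at $\sigma$.
  have : (fun n => conj (x n)) = 0 := by
    refine eq_zero_of_hasSum_zero (C := ‖x‖) (fun n => ?_) fun σ hσ => ?_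
    · rw [RCLike.norm_conj]; exact norm_apply_le_ell2 x n
    · have hσ' : (σ : ℂ) ∈ halfPlane (1 / 2) := by
        simp only [halfPlane, Set.mem_ofPred_eq, Complex.ofReal_re]; linarith
      have h := ell2_hasSum_inner x (expVec σ)
      rw [hx _ (Submodule.subset_span ⟨⟨σ, hσ'⟩, rfl⟩)] at h
      simpa only [expVec_apply hσ'] using h
  ext n
  simpa using congrFun this n

/-! ### Unitary models of the two spaces -/

/-- Conjugating the base point makes $s\mapsto\varkappa_{\overline s}$ holomorphic and gives this
family the same Gram matrix as `expVec`. -/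
lemma inner_szegoFun (u s : halfPlane (1 / 2)) :
    ⟪szegoFun (conjPt u), szegoFun (conjPt s)⟫_ℂ = szegoKernel s u := by
  have h : ⟪szegoFun (conjPt u), szegoFun (conjPt s)⟫_ℂ =
      ⟪(1 : ℂ), szegoFun (conjPt s) (conjPt u)⟫_ℂ := RKHS.kerFun_inner _ _ _
  rw [h, szegoFun_apply, RCLike.inner_apply', map_one, one_mul, szegoKernel, szegoKernel]
  congr 1
  simp [conjPt, add_comm]

lemma inner_muFun (u s : halfPlane (1 / 2)) :
    ⟪muFun (conjPt u), muFun (conjPt s)⟫_ℂ = muKernel s u := by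
  have h : ⟪muFun (conjPt u), muFun (conjPt s)⟫_ℂ =
      ⟪(1 : ℂ), muFun (conjPt s) (conjPt u)⟫_ℂ := RKHS.kerFun_inner _ _ _
  rw [h, muFun_apply, RCLike.inner_apply', map_one, one_mul, muKernel, muKernel]
  refine tsum_congr fun n => ?_
  congr 2
  simp [conjPt]
  ring

lemma conjPt_conjPt {δ : ℝ} (s : halfPlane δ) : conjPt (conjPt s) = s :=
  Subtype.ext (Complex.conj_conj _)

/-- The kernel functions of a scalar reproducing kernel Hilbert space are total. -/
lemma dense_span_kerFun (H : Type*) [NormedAddCommGroup H] [InnerProductSpace ℂ H]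
    [CompleteSpace H] [RKHS ℂ H (halfPlane (1 / 2)) ℂ] :
    Dense (Submodule.span ℂ (Set.range fun s : halfPlane (1 / 2) =>
      RKHS.kerFun H (conjPt s) (1 : ℂ)) : Set H) := by
  rw [Submodule.dense_iff_topologicalClosure_eq_top, eq_top_iff, ← RKHS.kerFun_dense (𝕜 := ℂ)
    (X := halfPlane (1 / 2)) (V := ℂ) H]
  refine Submodule.topologicalClosure_mono (Submodule.span_le.2 ?_)
  rintro _ ⟨x, v, rfl⟩
  have : RKHS.kerFun H x v = v • RKHS.kerFun H (conjPt (conjPt x)) (1 : ℂ) := by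
    rw [conjPt_conjPt, ← map_smul, smul_eq_mul, mul_one]
  rw [this]
  exact Submodule.smul_mem _ _ (Submodule.subset_span ⟨conjPt x, rfl⟩)

/-- `κ_μ = ζ + 1 / ζ`, in a form free of division. -/
lemma szegoKernel_mul_muKernel_sub (s u : halfPlane (1 / 2)) :
    szegoKernel s u * (muKernel s u - szegoKernel s u) = 1 := by
  have hs : 1 / 2 < (s : ℂ).re := s.2
  have hu : 1 / 2 < (u : ℂ).re := u.2
  have h : 1 < ((s : ℂ) + conj (u : ℂ)).re := by
    simp only [Complex.add_re, Complex.conj_re]; linarith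
  have h1 := ArithmeticFunction.LSeries_zeta_mul_Lseries_moebius h
  rw [ArithmeticFunction.LSeries_zeta_eq_riemannZeta h] at h1
  have h2 : muKernel s u - szegoKernel s u =
      LSeries (fun n => (ArithmeticFunction.moebius n : ℂ)) ((s : ℂ) + conj (u : ℂ)) := by
    refine ((hasSum_muKernel s u).sub (hasSum_szegoKernel s u)).unique ?_
    have h3 := ((ArithmeticFunction.LSeriesSummable_moebius_iff).2 h).LSeriesHasSum
    rw [LSeriesHasSum, ← PNat.coe_injective.hasSum_iff fun n hn => by
      rcases Nat.eq_zero_or_pos n with rfl | hn'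
      · simp
      · exact absurd ⟨⟨n, hn'⟩, rfl⟩ hn] at h3
    have h4 := (hasSum_pnat_iff (f := LSeries.term (fun n => (ArithmeticFunction.moebius n : ℂ))
      ((s : ℂ) + conj (u : ℂ)))).1 h3
    rw [show (fun n : ℕ => (1 + (ArithmeticFunction.moebius (n + 1) : ℂ)) *
        ((n + 1 : ℕ) : ℂ) ^ (-(s : ℂ) - conj (u : ℂ)) -
        ((n + 1 : ℕ) : ℂ) ^ (-(s : ℂ) - conj (u : ℂ))) = fun n => LSeries.term (fun n =>
        (ArithmeticFunction.moebius n : ℂ)) ((s : ℂ) + conj (u : ℂ)) (n + 1) from funext fun n => ?_]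
    · exact h4
    rw [LSeries.term_of_ne_zero n.succ_ne_zero, show -(s : ℂ) - conj (u : ℂ) =
      -((s : ℂ) + conj (u : ℂ)) by ring, Complex.cpow_neg]
    ring
  rw [h2, szegoKernel, h1]

lemma exists_linearIsometryEquiv_HTwo_ell2 : Nonempty (HTwo ≃ₗᵢ[ℂ] ell2) := by
  obtain ⟨U, -⟩ := exists_linearIsometryEquiv_of_inner_eq
    (fun s : halfPlane (1 / 2) => szegoFun (conjPt s)) (fun s => expVec s)
    (dense_span_kerFun HTwo) dense_span_expVec fun u s => by
      rw [inner_szegoFun, inner_expVec]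
  exact ⟨U⟩

lemma abs_moebius_real_le (n : ℕ) : |(ArithmeticFunction.moebius n : ℝ)| ≤ 1 := by
  exact_mod_cast ArithmeticFunction.abs_moebius_le_one (n := n)

/-- Positive integers with a nonzero weight in the kernel `κ_μ`. -/
abbrev MuIndex : Type := {k : ℕ+ // ArithmeticFunction.moebius k ≠ -1}

/-- $\mathscr H_\mu$ is infinite-dimensional because infinitely many weights $1+\mu(k)$ survive;
multiples of $4$ suffice, where $\mu=0$. -/
lemma nonempty_equiv_muIndex : Nonempty (ℕ+ ≃ MuIndex) := by
  have : Infinite MuIndex := by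
    refine Infinite.of_injective (fun n : ℕ+ => (⟨4 * n, ?_⟩ : MuIndex)) ?_
    · have : ¬ Squarefree ((4 * n : ℕ+) : ℕ) := fun h => by
        have := h 2 ⟨n, by push_cast; ring⟩
        exact absurd this (by decide)
      rw [ArithmeticFunction.moebius_eq_zero_of_not_squarefree this]
      decide
    · intro m n h
      simpa using h
  exact nonempty_equiv_of_countable

lemma exists_linearIsometryEquiv_HMu_ell2 : Nonempty (HMu ≃ₗᵢ[ℂ] ell2) := by
  obtain ⟨g⟩ := nonempty_equiv_muIndex
  let w : ℕ+ → ℝ := fun k => 1 + ArithmeticFunction.moebius k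
  have hw0 : ∀ k, 0 ≤ w k := fun k => by
    have := (abs_le.1 (abs_moebius_real_le k)).1
    simp only [w]; linarith
  have hw2 : ∀ k, w k ≤ 2 := fun k => by
    have := (abs_le.1 (abs_moebius_real_le k)).2
    simp only [w]; linarith
  -- Square roots of the weights split $\kappa_\mu$ as a Gram matrix. The reindexing `g` omits the
  -- indices of weight zero, whose coordinates would prevent totality.
  let c : ℂ → ℕ+ → ℂ := fun s n => (√(w (g n)) : ℂ) * ((((g n : ℕ+)) : ℕ) : ℂ) ^ (-s)
  have hmem : ∀ s : halfPlane (1 / 2), Memℓp (c s) 2 := fun s => by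
    refine (memℓp_gen_iff (by simp)).2 ?_
    have h1 := (sqSummable_univ (s : ℂ).re s.2).comp_injective
      (Subtype.val_injective.comp g.injective)
    simp only [ENNReal.toReal_ofNat, Real.rpow_two]
    refine (h1.mul_left 2).of_nonneg_of_le (fun _ => sq_nonneg _) fun n => ?_
    rw [norm_mul, mul_pow, Complex.norm_real, Real.norm_of_nonneg (Real.sqrt_nonneg _),
      Real.sq_sqrt (hw0 _), Function.comp_apply, Function.comp_apply, dirCoeff, Set.indicator_univ,
      norm_pnat_cpow, norm_pnat_cpow, Complex.ofReal_re]
    exact mul_le_mul_of_nonneg_right (hw2 _) (sq_nonneg _)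
  let v : halfPlane (1 / 2) → ell2 := fun s => ⟨c s, hmem s⟩
  have hv : ∀ s n, v s n = c s n := fun _ _ => rfl
  suffices h : Dense (Submodule.span ℂ (Set.range v) : Set ell2) ∧
      ∀ u s, ⟪muFun (conjPt u), muFun (conjPt s)⟫_ℂ = ⟪v u, v s⟫_ℂ by
    obtain ⟨U, -⟩ := exists_linearIsometryEquiv_of_inner_eq
      (fun s : halfPlane (1 / 2) => muFun (conjPt s)) v (dense_span_kerFun HMu) h.1 h.2
    exact ⟨U⟩
  constructor
  · rw [Submodule.dense_iff_topologicalClosure_eq_top, Submodule.topologicalClosure_eq_top_iff,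
      Submodule.eq_bot_iff]
    intro x hx
    rw [Submodule.mem_orthogonal'] at hx
    classical
    -- Extending by zero to the omitted indices turns orthogonality to all `v s` into the vanishing
    -- of an ordinary Dirichlet series.
    let d : ℕ+ → ℂ := fun k => if hk : ArithmeticFunction.moebius k ≠ -1 then
      conj (x (g.symm ⟨k, hk⟩)) * (√(w k) : ℂ) else 0
    have hd : ∀ n, d (g n) = conj (x n) * (√(w (g n)) : ℂ) := fun n => by
      simp only [d]
      rw [dif_pos (g n).2]
      simp
    have hd0 : d = 0 := by
      refine eq_zero_of_hasSum_zero (C := ‖x‖ * √2) (fun k => ?_) fun σ hσ => ?_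
      · by_cases hk : ArithmeticFunction.moebius k ≠ -1
        · simp only [d]
          rw [dif_pos hk, norm_mul, RCLike.norm_conj, Complex.norm_real,
            Real.norm_of_nonneg (Real.sqrt_nonneg _)]
          exact mul_le_mul (norm_apply_le_ell2 x _) (Real.sqrt_le_sqrt (hw2 k))
            (Real.sqrt_nonneg _) (norm_nonneg _)
        · simp only [d]
          rw [dif_neg hk, norm_zero]
          positivity
      · have hσ' : (σ : ℂ) ∈ halfPlane (1 / 2) := by
          simp only [halfPlane, Set.mem_ofPred_eq, Complex.ofReal_re]; linarith
        have h := ell2_hasSum_inner x (v ⟨σ, hσ'⟩)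
        rw [hx _ (Submodule.subset_span ⟨⟨σ, hσ'⟩, rfl⟩)] at h
        rw [← (Subtype.val_injective.comp g.injective).hasSum_iff]
        · convert h using 2 with n
          simp only [Function.comp_apply]
          rw [hd, hv]
          simp only [c]
          ring
        · intro k hk
          have : ¬ ArithmeticFunction.moebius k ≠ -1 := fun h =>
            hk ⟨g.symm ⟨k, h⟩, by simp⟩
          simp only [d]
          rw [dif_neg this, zero_mul]
    ext n
    have h0 := congrFun hd0 (g n)
    rw [hd, Pi.zero_apply, mul_eq_zero] at h0
    rcases h0 with h0 | h0
    · simpa using h0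
    · rw [Complex.ofReal_eq_zero, Real.sqrt_eq_zero (hw0 _)] at h0
      have : ArithmeticFunction.moebius (g n : ℕ+) = -1 := by
        have h1 : (ArithmeticFunction.moebius (g n : ℕ+) : ℝ) = -1 := by
          simp only [w] at h0; linarith
        exact_mod_cast h1
      exact absurd this (g n).2
  · intro u s
    rw [inner_muFun]
    refine HasSum.unique ?_ (ell2_hasSum_inner _ _)
    have h := (hasSum_pnat_iff (f := fun k => (1 + (ArithmeticFunction.moebius k : ℂ)) *
      (k : ℂ) ^ (-(s : ℂ) - conj (u : ℂ)))).2 (hasSum_muKernel s u)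
    rw [← (Subtype.val_injective.comp g.injective).hasSum_iff] at h
    · convert h using 2 with n
      simp only [Function.comp_apply, hv, c, map_mul, Complex.conj_ofReal, conj_pnat_cpow]
      have h1 : ((√(w (g n)) : ℝ) : ℂ) * ((√(w (g n)) : ℝ) : ℂ) =
          1 + (ArithmeticFunction.moebius (g n : ℕ+) : ℂ) := by
        rw [← Complex.ofReal_mul, Real.mul_self_sqrt (hw0 _)]
        simp [w]
      rw [← h1, show -(s : ℂ) - conj (u : ℂ) = -(conj (u : ℂ)) + -(s : ℂ) by ring,
        Complex.cpow_add _ _ (Nat.cast_ne_zero.2 (PNat.ne_zero _))]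
      ring
    · intro k hk
      have : ArithmeticFunction.moebius k = -1 := by
        by_contra h
        exact hk ⟨g.symm ⟨k, h⟩, by simp⟩
      simp [this]

/-- On the diagonal $\zeta(\kappa_\mu-\zeta)=1$ reads
$\|\varkappa\|^2(\|\kappa_\mu\|^2-\|\varkappa\|^2)=1$, so both factors are positive. -/
lemma szegoFun_norm_lt (s : halfPlane (1 / 2)) :
    szegoFun (conjPt s) ≠ 0 ∧ ‖szegoFun (conjPt s)‖ < ‖muFun (conjPt s)‖ := by
  have h := szegoKernel_mul_muKernel_sub s s
  rw [← inner_szegoFun, ← inner_muFun, inner_self_eq_norm_sq_to_K (𝕜 := ℂ),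
    inner_self_eq_norm_sq_to_K (𝕜 := ℂ)] at h
  have h' : ‖szegoFun (conjPt s)‖ ^ 2 *
      (‖muFun (conjPt s)‖ ^ 2 - ‖szegoFun (conjPt s)‖ ^ 2) = 1 := by
    exact Complex.ofReal_injective (by push_cast; exact h)
  have h0 : szegoFun (conjPt s) ≠ 0 := fun h0 => by
    rw [h0] at h'; simp at h'
  refine ⟨h0, lt_of_pow_lt_pow_left₀ 2 (norm_nonneg _) ?_⟩
  have : 0 < ‖szegoFun (conjPt s)‖ ^ 2 := by positivity
  by_contra hle
  push Not at hle
  nlinarith [mul_nonneg this.le (sub_nonneg.2 hle)]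

/-- There is an expanding isomorphism `ℋ² → ℋ_μ` matching the kernel functions at a point. -/
theorem exists_equiv_szegoFun_muFun (s : halfPlane (1 / 2)) :
    ∃ T : HTwo ≃L[ℂ] HMu, T (szegoFun (conjPt s)) = muFun (conjPt s) ∧
      ‖(T.symm : HMu →L[ℂ] HTwo)‖ < 1 := by
  obtain ⟨U₁⟩ := exists_linearIsometryEquiv_HTwo_ell2
  obtain ⟨U₂⟩ := exists_linearIsometryEquiv_HMu_ell2
  exact exists_continuousLinearEquiv_apply_eq (U₁.trans U₂.symm) (szegoFun_norm_lt s).1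
    (szegoFun_norm_lt s).2

section GaussianMeans

open MeasureTheory ProbabilityTheory

/-! ### Gaussian means along vertical lines -/

/-- The centred Gaussian measure of variance `k`. -/
abbrev gaussMean (k : ℕ) : Measure ℝ := gaussianReal 0 (k : NNReal)

/-- The oscillation `t ↦ e^{i l t}`. -/
def osc (l t : ℝ) : ℂ := Complex.exp (l * t * Complex.I)

lemma norm_osc (l t : ℝ) : ‖osc l t‖ = 1 := by
  rw [osc, ← Complex.ofReal_mul, Complex.norm_exp_ofReal_mul_I]

lemma continuous_osc (l : ℝ) : Continuous (osc l) := by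
  unfold osc; fun_prop

lemma osc_add (l l' t : ℝ) : osc (l + l') t = osc l t * osc l' t := by
  rw [osc, osc, osc, ← Complex.exp_add]
  congr 1
  push_cast
  ring

lemma conj_osc (l t : ℝ) : conj (osc l t) = osc (-l) t := by
  rw [osc, osc, ← Complex.exp_conj]
  congr 1
  simp

lemma integrable_osc (k : ℕ) (l : ℝ) : Integrable (osc l) (gaussMean k) :=
  Integrable.of_bound (continuous_osc l).aestronglyMeasurable 1
    (Filter.Eventually.of_forall fun t => (norm_osc l t).le)

/-- The Gaussian weight `e^{-k l² / 2}`. -/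
def gaussWeight (k : ℕ) (l : ℝ) : ℝ := Real.exp (-(k * l ^ 2 / 2))

lemma integral_osc (k : ℕ) (l : ℝ) : ∫ t, osc l t ∂gaussMean k = gaussWeight k l := by
  have h := charFun_gaussianReal (μ := 0) (v := (k : NNReal)) l
  rw [charFun_apply_real] at h
  refine Eq.trans h ?_
  rw [gaussWeight, Complex.ofReal_exp]
  congr 1
  push_cast
  ring

lemma gaussWeight_nonneg (k : ℕ) (l : ℝ) : 0 ≤ gaussWeight k l := (Real.exp_pos _).le

lemma gaussWeight_le {k k' : ℕ} (h : k ≤ k') (l : ℝ) : gaussWeight k' l ≤ gaussWeight k l := by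
  refine Real.exp_le_exp.2 (neg_le_neg ?_)
  have : (k : ℝ) ≤ k' := Nat.cast_le.2 h
  gcongr

lemma tendsto_gaussWeight (l : ℝ) :
    Filter.Tendsto (fun k : ℕ => gaussWeight k l) Filter.atTop (nhds (if l = 0 then 1 else 0)) := by
  split_ifs with h
  · simp [gaussWeight, h]
  · have hl : 0 < l ^ 2 / 2 := by positivity
    refine Real.tendsto_exp_neg_atTop_nhds_zero.comp ?_
    refine (tendsto_natCast_atTop_atTop.atTop_mul_const hl).congr fun k => ?_
    ring

lemma pnat_cpow_add_mul_I (n : ℕ+) (s : ℂ) (t : ℝ) :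
    ((n : ℕ) : ℂ) ^ (-(s + t * Complex.I)) =
      ((n : ℕ) : ℂ) ^ (-s) * osc (-Real.log n) t := by
  have h0 : ((n : ℕ) : ℂ) ≠ 0 := Nat.cast_ne_zero.2 n.ne_zero
  rw [neg_add, Complex.cpow_add _ _ h0, osc, Complex.cpow_def_of_ne_zero h0 (-(t * Complex.I)),
    ← Complex.natCast_log]
  congr 2
  push_cast
  ring

/-- In the variable $\log n$ the Gaussian beats every power of $n$; completing the square leaves a
constant times $n^{-2}$. For $k=0$ the weight is identically $1$, hence the hypothesis `hk`. -/
lemma summable_rpow_mul_gaussWeight {k : ℕ} (hk : 1 ≤ k) (A l : ℝ) :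
    Summable fun n : ℕ+ => ((n : ℕ) : ℝ) ^ A * gaussWeight k (l - Real.log n) := by
  have h : Summable fun n : ℕ+ => Real.exp ((A + 2) * l + (A + 2) ^ 2 / 2) *
      (((n : ℕ) : ℝ) ^ 2)⁻¹ :=
    ((Real.summable_nat_pow_inv.2 one_lt_two).comp_injective PNat.coe_injective).mul_left _
  refine h.of_nonneg_of_le (fun n => mul_nonneg (by positivity) (gaussWeight_nonneg _ _)) fun n => ?_
  have hn : 0 < ((n : ℕ) : ℝ) := Nat.cast_pos.2 n.pos
  refine (mul_le_mul_of_nonneg_left (gaussWeight_le hk _) (by positivity)).trans ?_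
  rw [← Real.rpow_natCast (n : ℝ) 2, ← Real.rpow_neg hn.le, Real.rpow_def_of_pos hn, Real.rpow_def_of_pos hn,
    gaussWeight, ← Real.exp_add, ← Real.exp_add, Real.exp_le_exp]
  push_cast
  nlinarith [sq_nonneg (A + 2 - (Real.log n - l))]

/-! ### Bohr coefficients of bounded Dirichlet series -/

/-- `φ` is the sum of the absolutely convergent series `∑ a n * n ^ (-s)` for `Re s > A + 1`, with
coefficients of polynomial growth. -/
structure HasDirichletCoeff (φ : ℂ → ℂ) (a : ℕ+ → ℂ) (A C : ℝ) : Prop where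
  norm_le : ∀ n, ‖a n‖ ≤ C * ((n : ℕ) : ℝ) ^ A
  hasSum : ∀ s ∈ halfPlane (A + 1), HasSum (fun n : ℕ+ => a n * ((n : ℕ) : ℂ) ^ (-s)) (φ s)

lemma summable_norm_mul_cpow {a : ℕ+ → ℂ} {A C : ℝ} (h : ∀ n, ‖a n‖ ≤ C * ((n : ℕ) : ℝ) ^ A)
    {s : ℂ} (hs : s ∈ halfPlane (A + 1)) :
    Summable fun n : ℕ+ => ‖a n * ((n : ℕ) : ℂ) ^ (-s)‖ := by
  have hs' : 1 < s.re - A := by have : A + 1 < s.re := hs; linarith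
  have h1 := (((Real.summable_nat_rpow_inv.2 hs').comp_injective PNat.coe_injective).mul_left C)
  refine h1.of_nonneg_of_le (fun _ => norm_nonneg _) fun n => ?_
  have hn : 0 < ((n : ℕ) : ℝ) := Nat.cast_pos.2 n.pos
  rw [norm_mul, norm_pnat_cpow]
  refine (mul_le_mul_of_nonneg_right (h n) (by positivity)).trans (le_of_eq ?_)
  rw [mul_assoc, ← Real.rpow_add hn, Function.comp_apply, ← Real.rpow_neg hn.le]
  congr 2
  ring

/-- The terms of the convergent series at $\sigma+1$ are bounded, so $c_n=O(n^{\sigma+1})$; this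
trades conditional convergence for absolute convergence further right. -/
lemma IsDirichletSeries.exists_hasDirichletCoeff {φ : ℂ → ℂ} (h : IsDirichletSeries φ) :
    ∃ a A C, HasDirichletCoeff φ a A C := by
  obtain ⟨c, σ, hσ, hc⟩ := h
  have hsucc : ∀ (s : ℂ) (N : ℕ), ∑ n ∈ Finset.Icc 1 N, c n * (n : ℂ) ^ (-s) =
      ∑ n ∈ Finset.range N, c (n + 1) * ((n + 1 : ℕ) : ℂ) ^ (-s) := fun s N => by
    rw [Finset.range_eq_Ico, Finset.sum_Ico_add' (fun n => c n * (n : ℂ) ^ (-s)) 0 N 1]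
    rfl
  simp only [hsucc] at hc
  have h1 : ((σ + 1 : ℝ) : ℂ) ∈ halfPlane σ := by
    simp [halfPlane]
  have h0 : Filter.Tendsto (fun n : ℕ => c (n + 1) * ((n + 1 : ℕ) : ℂ) ^ (-((σ + 1 : ℝ) : ℂ)))
      Filter.atTop (nhds 0) := by
    have h2 := ((hc _ h1).comp (Filter.tendsto_add_atTop_nat 1)).sub (hc _ h1)
    rw [sub_self] at h2
    refine h2.congr fun n => ?_
    rw [Function.comp_apply, Finset.sum_range_succ, add_sub_cancel_left]
  obtain ⟨C, hC⟩ := (Metric.isBounded_range_of_tendsto _ h0).exists_norm_le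
  have hb : ∀ n : ℕ+, ‖c n‖ ≤ C * ((n : ℕ) : ℝ) ^ (σ + 1) := fun n => by
    have hn : 0 < ((n : ℕ) : ℝ) := Nat.cast_pos.2 n.pos
    have h3 := hC _ ⟨n.natPred, rfl⟩
    simp only [PNat.natPred_add_one] at h3
    rw [norm_mul, norm_pnat_cpow, Complex.ofReal_re, Real.rpow_neg hn.le, ← div_eq_mul_inv,
      div_le_iff₀ (Real.rpow_pos_of_pos hn _)] at h3
    exact h3
  refine ⟨fun n => c n, σ + 1, C, hb, fun s hs => ?_⟩
  have hsum := (summable_norm_mul_cpow hb hs).of_norm.hasSum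
  have hsum' := (hasSum_pnat_iff (f := fun n => c n * (n : ℂ) ^ (-s))).1 hsum
  have hs' : s ∈ halfPlane σ := halfPlane_anti (by linarith) hs
  rw [tendsto_nhds_unique (hc s hs') hsum'.tendsto_sum_nat]
  exact hsum

section Coefficients

variable {φ : ℂ → ℂ} {a : ℕ+ → ℂ} {A C : ℝ}

lemma add_mul_I_mem {δ : ℝ} {s : ℂ} (hs : s ∈ halfPlane δ) (t : ℝ) :
    s + t * Complex.I ∈ halfPlane δ := by
  simpa [halfPlane] using hs

lemma MemUnitBallHInfty.continuous_vertical (hφ : MemUnitBallHInfty φ) {s : ℂ}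
    (hs : s ∈ halfPlane 0) : Continuous fun t : ℝ => φ (s + t * Complex.I) :=
  hφ.1.continuousOn.comp_continuous (by fun_prop) (add_mul_I_mem hs)

lemma MemUnitBallHInfty.integrable (hφ : MemUnitBallHInfty φ) {s : ℂ} (hs : s ∈ halfPlane 0)
    (k : ℕ) (l : ℝ) :
    Integrable (fun t : ℝ => φ (s + t * Complex.I) * osc l t) (gaussMean k) :=
  Integrable.of_bound ((hφ.continuous_vertical hs).mul (continuous_osc l)).aestronglyMeasurable 1
    (Filter.Eventually.of_forall fun t => by
      rw [norm_mul, norm_osc, mul_one]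
      exact hφ.2 _ (add_mul_I_mem hs t))

/-- Vertical Gaussian means of a bounded holomorphic function are holomorphic. -/
lemma MemUnitBallHInfty.differentiableOn_mean (hφ : MemUnitBallHInfty φ) (k : ℕ) (l : ℝ) :
    DifferentiableOn ℂ (fun s => ∫ t : ℝ, φ (s + t * Complex.I) * osc l t ∂gaussMean k)
      (halfPlane 0) := by
  intro s hs
  have hs0 : 0 < s.re := hs
  have hsub : ∀ x ∈ halfPlane (s.re / 2), x ∈ halfPlane 0 := fun x hx =>
    halfPlane_anti (by linarith) hx
  have hderiv : ContinuousOn (deriv φ) (halfPlane 0) :=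
    (hφ.1.deriv (halfPlane_isOpen 0)).continuousOn
  -- The dominating constant is Cauchy's estimate on discs of radius $\operatorname{Re}s/4$, which
  -- stay in $\mathbb H_0$ when centred in $\operatorname{Re}>\operatorname{Re}s/2$.
  refine (hasDerivAt_integral_of_dominated_loc_of_deriv_le (bound := fun _ => 1 / (s.re / 4))
    (s := halfPlane (s.re / 2))
    (μ := gaussMean k) (F := fun x (t : ℝ) => φ (x + t * Complex.I) * osc l t)
    (F' := fun x (t : ℝ) => deriv φ (x + t * Complex.I) * osc l t)
    ((halfPlane_isOpen _).mem_nhds (show s.re / 2 < s.re by linarith)) ?_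
    (hφ.integrable hs k l) ?_ ?_ (integrable_const _) ?_).2.differentiableAt.differentiableWithinAt
  · filter_upwards [(halfPlane_isOpen 0).mem_nhds hs] with x hx
    exact (hφ.integrable hx k l).aestronglyMeasurable
  · exact ((hderiv.comp_continuous (by fun_prop) (add_mul_I_mem hs)).mul
      (continuous_osc l)).aestronglyMeasurable
  · refine Filter.Eventually.of_forall fun t x hx => ?_
    rw [norm_mul, norm_osc, mul_one]
    have hball : ∀ z ∈ Metric.closedBall (x + t * Complex.I) (s.re / 4), z ∈ halfPlane 0 := by
      intro z hz
      have h1 : |(z - (x + t * Complex.I)).re| ≤ s.re / 4 :=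
        (Complex.abs_re_le_norm _).trans (by simpa [dist_eq_norm] using hz)
      have h2 := (abs_le.1 h1).1
      have h3 : s.re / 2 < (x + t * Complex.I).re := add_mul_I_mem hx t
      rw [Complex.sub_re] at h2
      show 0 < z.re
      linarith
    refine Complex.norm_deriv_le_of_forall_mem_sphere_norm_le (by linarith) ?_ fun z hz =>
      hφ.2 z (hball z (Metric.sphere_subset_closedBall hz))
    refine DifferentiableOn.diffContOnCl (hφ.1.mono fun z hz => hball z ?_)
    exact Metric.closure_ball_subset_closedBall hz
  · refine Filter.Eventually.of_forall fun t x hx => ?_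
    have h1 : HasDerivAt φ (deriv φ (x + t * Complex.I)) (x + t * Complex.I) :=
      (hφ.1.differentiableAt ((halfPlane_isOpen 0).mem_nhds
        (add_mul_I_mem (hsub x hx) t))).hasDerivAt
    exact (h1.comp_add_const x (t * Complex.I)).mul_const _

/-- The Gaussian mean of `φ(s + it) e^{ilt}` in terms of the Dirichlet coefficients. -/
theorem MemUnitBallHInfty.mean_eq (hφ : MemUnitBallHInfty φ) (ha : HasDirichletCoeff φ a A C)
    {k : ℕ} (hk : 1 ≤ k) (l : ℝ) {s : ℂ} (hs : s ∈ halfPlane 0) :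
    ∫ t : ℝ, φ (s + t * Complex.I) * osc l t ∂gaussMean k =
      ∑' n : ℕ+, a n * ((n : ℕ) : ℂ) ^ (-s) * gaussWeight k (l - Real.log n) := by
  have hsumm := (summable_rpow_mul_gaussWeight hk A l).mul_left C
  -- Both sides are holomorphic on $\mathbb H_0$, the series because the Gaussian weights force
  -- convergence there. It is enough to integrate term by term where the Dirichlet series converges
  -- absolutely.
  refine eqOn_halfPlane_of_eqOn (σ := A + 1) (g := fun s => ∑' n : ℕ+,
    a n * ((n : ℕ) : ℂ) ^ (-s) * gaussWeight k (l - Real.log n)) (hφ.differentiableOn_mean k l) ?_ ?_ hs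
  · refine Complex.differentiableOn_tsum_of_summable_norm hsumm (fun n => ?_) (halfPlane_isOpen 0)
      fun n w hw => ?_
    · exact (((differentiable_natCast_cpow_neg n).const_mul _).mul_const _).differentiableOn
    · have hw0 : 0 < w.re := hw
      rw [norm_mul, norm_mul, norm_pnat_cpow, Complex.norm_real,
        Real.norm_of_nonneg (gaussWeight_nonneg _ _), ← mul_assoc]
      refine mul_le_mul_of_nonneg_right ?_ (gaussWeight_nonneg _ _)
      refine (mul_le_of_le_one_right (norm_nonneg _) ?_).trans (ha.norm_le n)
      exact Real.rpow_le_one_of_one_le_of_nonpos (by exact_mod_cast n.pos) (by linarith)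
  · intro s hs
    have hexp : ∀ t : ℝ, φ (s + t * Complex.I) * osc l t =
        ∑' n : ℕ+, a n * ((n : ℕ) : ℂ) ^ (-s) * osc (l - Real.log n) t := fun t => by
      rw [← (ha.hasSum _ (add_mul_I_mem hs t)).tsum_eq, ← tsum_mul_right]
      refine tsum_congr fun n => ?_
      rw [pnat_cpow_add_mul_I, sub_eq_add_neg, osc_add]
      ring
    have hs2 := hasSum_integral_of_summable_integral_norm (μ := gaussMean k)
      (F := fun (n : ℕ+) t => a n * ((n : ℕ) : ℂ) ^ (-s) * osc (l - Real.log n) t)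
      (fun n => (integrable_osc k _).const_mul _) (by
        simp only [norm_mul, norm_osc, mul_one, integral_const, probReal_univ, smul_eq_mul, one_mul]
        simpa only [norm_mul] using summable_norm_mul_cpow ha.norm_le hs)
    simp only [hexp]
    rw [← hs2.tsum_eq]
    refine tsum_congr fun n => ?_
    rw [integral_const_mul, integral_osc]

/-- Gaussian means of wide variance recover the Dirichlet coefficients. -/
theorem MemUnitBallHInfty.tendsto_mean (hφ : MemUnitBallHInfty φ)
    (ha : HasDirichletCoeff φ a A C) (l : ℝ) {s : ℂ} (hs : s ∈ halfPlane 0) :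
    Filter.Tendsto (fun k : ℕ => ∫ t : ℝ, φ (s + t * Complex.I) * osc l t ∂gaussMean k)
      Filter.atTop (nhds (∑' n : ℕ+, a n * ((n : ℕ) : ℂ) ^ (-s) *
        ((if l - Real.log n = 0 then 1 else 0 : ℝ) : ℂ))) := by
  have hlim := tendsto_tsum_of_dominated_convergence
    (f := fun (k : ℕ) (n : ℕ+) => a n * ((n : ℕ) : ℂ) ^ (-s) *
      (gaussWeight k (l - Real.log n) : ℂ)) (𝓕 := Filter.atTop)
    ((summable_rpow_mul_gaussWeight le_rfl A l).mul_left C)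
    (fun n => ((Complex.continuous_ofReal.tendsto _).comp
      (tendsto_gaussWeight (l - Real.log n))).const_mul (a n * ((n : ℕ) : ℂ) ^ (-s))) ?_
  · refine hlim.congr' ?_
    filter_upwards [Filter.eventually_ge_atTop 1] with k hk
    exact (hφ.mean_eq ha hk l hs).symm
  · filter_upwards [Filter.eventually_ge_atTop 1] with k hk n
    have hs0 : 0 < s.re := hs
    rw [norm_mul, norm_mul, norm_pnat_cpow, Complex.norm_real,
      Real.norm_of_nonneg (gaussWeight_nonneg _ _), ← mul_assoc]
    refine mul_le_mul ?_ (gaussWeight_le hk _) (gaussWeight_nonneg _ _)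
      ((norm_nonneg _).trans (ha.norm_le n))
    refine (mul_le_of_le_one_right (norm_nonneg _) ?_).trans (ha.norm_le n)
    exact Real.rpow_le_one_of_one_le_of_nonpos (by exact_mod_cast n.pos) (by linarith)

end Coefficients

/-! ### Bounded Dirichlet series act contractively on `ℓ²` -/

open Classical in
/-- The entry `a (n / m)` if `m ∣ n`, and `0` otherwise. -/
def divCoeff (a : ℕ+ → ℂ) (m n : ℕ+) : ℂ := if h : ∃ d, d * m = n then a h.choose else 0

lemma divCoeff_mul (a : ℕ+ → ℂ) (m d : ℕ+) : divCoeff a m (d * m) = a d := by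
  have h : ∃ d', d' * m = d * m := ⟨d, rfl⟩
  rw [divCoeff, dif_pos h, mul_right_cancel h.choose_spec]

lemma divCoeff_of_not (a : ℕ+ → ℂ) {m n : ℕ+} (h : ¬ ∃ d, d * m = n) : divCoeff a m n = 0 :=
  dif_neg h

/-- The frequency $\log n-\log m$ selects the single coefficient with $dm=n$, by injectivity of the
logarithm. -/
lemma tsum_mul_ite_log_eq (a : ℕ+ → ℂ) (m n : ℕ+) :
    ∑' d : ℕ+, a d * ((if Real.log n - Real.log m - Real.log d = 0 then 1 else 0 : ℝ) : ℂ) =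
      divCoeff a m n := by
  have key : ∀ d : ℕ+, Real.log n - Real.log m - Real.log d = 0 ↔ d * m = n := fun d => by
    have hd : (0 : ℝ) < (d : ℕ) := Nat.cast_pos.2 d.pos
    have hm : (0 : ℝ) < (m : ℕ) := Nat.cast_pos.2 m.pos
    have hn : (0 : ℝ) < (n : ℕ) := Nat.cast_pos.2 n.pos
    rw [sub_sub, sub_eq_zero, add_comm, ← Real.log_mul hd.ne' hm.ne']
    constructor
    · intro h
      have := Real.log_injOn_pos (Set.mem_Ioi.2 hn) (Set.mem_Ioi.2 (mul_pos hd hm)) h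
      exact PNat.coe_injective (by exact_mod_cast this.symm)
    · rintro rfl
      push_cast
      rfl
  simp only [key]
  by_cases h : ∃ d, d * m = n
  · obtain ⟨d, rfl⟩ := h
    rw [divCoeff_mul, tsum_eq_single d fun d' hd' => by
      rw [if_neg fun h => hd' (mul_right_cancel h)]; simp]
    simp
  · rw [divCoeff_of_not a h]
    push Not at h
    simp [h]

/-- The trigonometric polynomial with coefficients `x` and frequencies `f`. -/
def trigPoly (F : Finset ℕ+) (x : ℕ+ → ℂ) (f : ℕ+ → ℝ) (t : ℝ) : ℂ := ∑ m ∈ F, x m * osc (f m) t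

lemma continuous_trigPoly (F : Finset ℕ+) (x : ℕ+ → ℂ) (f : ℕ+ → ℝ) :
    Continuous (trigPoly F x f) :=
  continuous_finsetSum _ fun m _ => continuous_const.mul (continuous_osc (f m))

lemma norm_trigPoly_le (F : Finset ℕ+) (x : ℕ+ → ℂ) (f : ℕ+ → ℝ) (t : ℝ) :
    ‖trigPoly F x f t‖ ≤ ∑ m ∈ F, ‖x m‖ :=
  norm_sum_le_of_le _ fun m _ => by rw [norm_mul, norm_osc, mul_one]

lemma integrable_norm_trigPoly_sq (k : ℕ) (F : Finset ℕ+) (x : ℕ+ → ℂ) (f : ℕ+ → ℝ) :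
    Integrable (fun t => ‖trigPoly F x f t‖ ^ 2) (gaussMean k) :=
  Integrable.of_bound ((continuous_trigPoly F x f).norm.pow 2).aestronglyMeasurable
    ((∑ m ∈ F, ‖x m‖) ^ 2) (Filter.Eventually.of_forall fun t => by
      rw [Real.norm_of_nonneg (sq_nonneg _)]
      exact pow_le_pow_left₀ (norm_nonneg _) (norm_trigPoly_le F x f t) 2)

/-- Distinct frequencies become orthogonal as the variance grows, so only the diagonal survives. -/
lemma tendsto_mean_norm_trigPoly_sq (F : Finset ℕ+) (x : ℕ+ → ℂ) {f : ℕ+ → ℝ}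
    (hf : Function.Injective f) :
    Filter.Tendsto (fun k : ℕ => ∫ t, ‖trigPoly F x f t‖ ^ 2 ∂gaussMean k) Filter.atTop
      (nhds (∑ m ∈ F, ‖x m‖ ^ 2)) := by
  have hexp : ∀ k : ℕ, ((∫ t, ‖trigPoly F x f t‖ ^ 2 ∂gaussMean k : ℝ) : ℂ) =
      ∑ m ∈ F, ∑ n ∈ F, conj (x m) * x n * (gaussWeight k (f n - f m) : ℂ) := fun k => by
    rw [← integral_complex_ofReal]
    have h1 : ∀ t, ((‖trigPoly F x f t‖ ^ 2 : ℝ) : ℂ) =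
        ∑ m ∈ F, ∑ n ∈ F, conj (x m) * x n * osc (f n - f m) t := fun t => by
      rw [Complex.ofReal_pow, ← Complex.conj_mul', trigPoly, map_sum, Finset.sum_mul_sum]
      refine Finset.sum_congr rfl fun m _ => Finset.sum_congr rfl fun n _ => ?_
      rw [map_mul, conj_osc, sub_eq_add_neg, osc_add]
      ring
    simp only [h1]
    rw [integral_finsetSum _ fun m _ => integrable_finsetSum _ fun n _ =>
      (integrable_osc k _).const_mul _]
    refine Finset.sum_congr rfl fun m _ => ?_
    rw [integral_finsetSum _ fun n _ => (integrable_osc k _).const_mul _]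
    refine Finset.sum_congr rfl fun n _ => ?_
    rw [integral_const_mul, integral_osc]
  have hlim : Filter.Tendsto (fun k : ℕ => ∑ m ∈ F, ∑ n ∈ F,
      conj (x m) * x n * (gaussWeight k (f n - f m) : ℂ)) Filter.atTop
      (nhds (∑ m ∈ F, ∑ n ∈ F, conj (x m) * x n *
        ((if f n - f m = 0 then 1 else 0 : ℝ) : ℂ))) :=
    tendsto_finsetSum _ fun m _ => tendsto_finsetSum _ fun n _ =>
      ((Complex.continuous_ofReal.tendsto _).comp (tendsto_gaussWeight _)).const_mul _
  have hval : ∑ m ∈ F, ∑ n ∈ F, conj (x m) * x n * ((if f n - f m = 0 then 1 else 0 : ℝ) : ℂ) =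
      ((∑ m ∈ F, ‖x m‖ ^ 2 : ℝ) : ℂ) := by
    rw [Complex.ofReal_sum]
    refine Finset.sum_congr rfl fun m hm => ?_
    rw [Finset.sum_eq_single m, sub_self, if_pos rfl, Complex.ofReal_one, mul_one,
      Complex.conj_mul', Complex.ofReal_pow]
    · intro n _ hn
      rw [if_neg fun h => hn (hf (sub_eq_zero.1 h)), Complex.ofReal_zero, mul_zero]
    · exact fun h => absurd hm h
  rw [hval] at hlim
  simp only [← hexp] at hlim
  exact (Complex.continuous_re.tendsto _).comp hlim

section Contraction

variable {φ : ℂ → ℂ} {a : ℕ+ → ℂ} {A C : ℝ}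

lemma log_pnat_injective : Function.Injective fun n : ℕ+ => Real.log n := fun m n h =>
  PNat.coe_injective (by
    exact_mod_cast Real.log_injOn_pos (Set.mem_Ioi.2 (Nat.cast_pos.2 m.pos))
      (Set.mem_Ioi.2 (Nat.cast_pos.2 n.pos)) h)

/-- The form is the limiting Gaussian mean of $\varphi(\varepsilon+it)X(t)Y(t)$, with `X` of
frequencies $-\log m$ and `Y` of frequencies $\log n$. The bound is $|XY|\le(|X|^2+|Y|^2)/2$ in the
mean; the shift keeps the line inside $\mathbb H_0$. -/
lemma MemUnitBallHInfty.norm_sum_divCoeff_shift_le (hφ : MemUnitBallHInfty φ)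
    (ha : HasDirichletCoeff φ a A C) {ε : ℝ} (hε : 0 < ε) (F G : Finset ℕ+) (x y : ℕ+ → ℂ) :
    ‖∑ m ∈ F, ∑ n ∈ G, x m * y n *
        divCoeff (fun d => a d * ((d : ℕ) : ℂ) ^ (-(ε : ℂ))) m n‖ ≤
      (∑ m ∈ F, ‖x m‖ ^ 2 + ∑ n ∈ G, ‖y n‖ ^ 2) / 2 := by
  have hε' : (ε : ℂ) ∈ halfPlane 0 := by simpa [halfPlane] using hε
  let X := trigPoly F x fun m => -Real.log m
  let Y := trigPoly G y fun n => Real.log n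
  have hexp : ∀ k : ℕ, ∫ t : ℝ, φ (ε + t * Complex.I) * (X t * Y t) ∂gaussMean k =
      ∑ m ∈ F, ∑ n ∈ G, x m * y n *
        ∫ t : ℝ, φ (ε + t * Complex.I) * osc (Real.log n - Real.log m) t ∂gaussMean k := fun k => by
    have h1 : ∀ t : ℝ, φ (ε + t * Complex.I) * (X t * Y t) = ∑ m ∈ F, ∑ n ∈ G, x m * y n *
        (φ (ε + t * Complex.I) * osc (Real.log n - Real.log m) t) := fun t => by
      simp only [X, Y, trigPoly]
      rw [Finset.sum_mul_sum, Finset.mul_sum]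
      refine Finset.sum_congr rfl fun m _ => ?_
      rw [Finset.mul_sum]
      refine Finset.sum_congr rfl fun n _ => ?_
      rw [sub_eq_add_neg, osc_add]
      ring
    simp only [h1]
    rw [integral_finsetSum _ fun m _ => integrable_finsetSum _ fun n _ =>
      (hφ.integrable hε' k _).const_mul _]
    refine Finset.sum_congr rfl fun m _ => ?_
    rw [integral_finsetSum _ fun n _ => (hφ.integrable hε' k _).const_mul _]
    refine Finset.sum_congr rfl fun n _ => ?_
    rw [integral_const_mul]
  have hlim : Filter.Tendsto (fun k : ℕ => ∫ t : ℝ, φ (ε + t * Complex.I) * (X t * Y t)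
      ∂gaussMean k) Filter.atTop (nhds (∑ m ∈ F, ∑ n ∈ G, x m * y n *
        divCoeff (fun d => a d * ((d : ℕ) : ℂ) ^ (-(ε : ℂ))) m n)) := by
    simp only [hexp, ← tsum_mul_ite_log_eq]
    exact tendsto_finsetSum _ fun m _ => tendsto_finsetSum _ fun n _ =>
      (hφ.tendsto_mean ha _ hε').const_mul _
  have hX := tendsto_mean_norm_trigPoly_sq F x (f := fun m => -Real.log m)
    (neg_injective.comp log_pnat_injective)
  have hY := tendsto_mean_norm_trigPoly_sq G y (f := fun n => Real.log n) log_pnat_injective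
  refine le_of_tendsto_of_tendsto' hlim.norm ((hX.add hY).div_const 2) fun k => ?_
  have hXi := integrable_norm_trigPoly_sq k F x fun m => -Real.log m
  have hYi := integrable_norm_trigPoly_sq k G y fun n => Real.log n
  rw [← integral_add hXi hYi, ← integral_div]
  refine norm_integral_le_of_norm_le ((hXi.add hYi).div_const 2)
    (Filter.Eventually.of_forall fun t => ?_)
  rw [norm_mul, norm_mul]
  have h1 : ‖φ (ε + t * Complex.I)‖ ≤ 1 := hφ.2 _ (add_mul_I_mem hε' t)
  have h2 : 0 ≤ ‖X t‖ * ‖Y t‖ := by positivity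
  have h3 : ‖X t‖ * ‖Y t‖ ≤ (‖X t‖ ^ 2 + ‖Y t‖ ^ 2) / 2 := by
    nlinarith [sq_nonneg (‖X t‖ - ‖Y t‖)]
  exact (mul_le_of_le_one_left h2 h1).trans h3

/-- Only finitely many coefficients occur, so $\varepsilon\to0^+$ is harmless. -/
lemma MemUnitBallHInfty.norm_sum_divCoeff_le (hφ : MemUnitBallHInfty φ)
    (ha : HasDirichletCoeff φ a A C) (F G : Finset ℕ+) (x y : ℕ+ → ℂ) :
    ‖∑ m ∈ F, ∑ n ∈ G, x m * y n * divCoeff a m n‖ ≤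
      (∑ m ∈ F, ‖x m‖ ^ 2 + ∑ n ∈ G, ‖y n‖ ^ 2) / 2 := by
  have hlim : Filter.Tendsto (fun ε : ℝ => ∑ m ∈ F, ∑ n ∈ G, x m * y n *
      divCoeff (fun d => a d * ((d : ℕ) : ℂ) ^ (-(ε : ℂ))) m n) (nhdsWithin 0 (Set.Ioi 0))
      (nhds (∑ m ∈ F, ∑ n ∈ G, x m * y n * divCoeff a m n)) := by
    refine tendsto_finsetSum _ fun m _ => tendsto_finsetSum _ fun n _ =>
      Filter.Tendsto.const_mul _ (Filter.Tendsto.mono_left ?_ nhdsWithin_le_nhds)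
    by_cases h : ∃ d, d * m = n
    · obtain ⟨d, rfl⟩ := h
      simp only [divCoeff_mul]
      have hc : Continuous fun ε : ℝ => a d * ((d : ℕ) : ℂ) ^ (-(ε : ℂ)) :=
        continuous_const.mul ((differentiable_natCast_cpow_neg d).continuous.comp
          Complex.continuous_ofReal)
      simpa using hc.tendsto 0
    · simp only [divCoeff_of_not _ h]
      exact tendsto_const_nhds
  refine le_of_tendsto hlim.norm ?_
  filter_upwards [self_mem_nhdsWithin] with ε hε
  exact hφ.norm_sum_divCoeff_shift_le ha hε F G x y

/-- The `n`-th column `∑_{m ∣ n} a (n / m) δ_m`. -/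
def divColumn (a : ℕ+ → ℂ) (n : ℕ+) : ell2 :=
  ∑ m ∈ Finset.Icc 1 n, lp.single 2 m (divCoeff a m n)

lemma divColumn_apply (a : ℕ+ → ℂ) (m n : ℕ+) : divColumn a n m = divCoeff a m n := by
  rw [divColumn, lp.coeFn_sum, Finset.sum_apply]
  simp only [lp.single_apply, Pi.single_apply, Finset.sum_ite_eq, Finset.mem_Icc]
  split_ifs with h
  · rfl
  · refine (divCoeff_of_not a ?_).symm
    rintro ⟨d, rfl⟩
    exact h ⟨one_le, le_mul_of_one_le_left' one_le⟩

/-- A function in the unit ball with a Dirichlet series is a contractive multiplier: the transposed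
multiplication operator has the vectors `(n ^ (-s))_n` as eigenvectors. -/
theorem MemUnitBallHInfty.exists_contraction (hφ : MemUnitBallHInfty φ)
    (hD : IsDirichletSeries φ) :
    ∃ N : ell2 →L[ℂ] ell2, ‖N‖ ≤ 1 ∧ ∀ s ∈ halfPlane (1 / 2), N (expVec s) = φ s • expVec s := by
  obtain ⟨a, A, C, ha⟩ := hD.exists_hasDirichletCoeff
  obtain ⟨N, hN, hNδ⟩ := exists_contraction_of_norm_le
    (fun n : ℕ+ => (lp.single 2 n (1 : ℂ) : ell2)) (divColumn a) fun c => by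
      have hc : ‖Finsupp.linearCombination ℂ (fun n : ℕ+ => (lp.single 2 n (1 : ℂ) : ell2)) c‖ ^ 2 =
          ∑ n ∈ c.support, ‖c n‖ ^ 2 := by
        have h := lp.norm_sum_single (p := 2) (by simp) (fun n => c n) c.support
        simp only [ENNReal.toReal_ofNat, Real.rpow_two] at h
        rw [← h, Finsupp.linearCombination_apply, Finsupp.sum]
        congr 2
        refine Finset.sum_congr rfl fun n _ => ?_
        rw [← lp.single_smul, smul_eq_mul, mul_one]
      refine lp.norm_le_of_forall_sum_le (by simp) (norm_nonneg _) fun F => ?_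
      simp only [ENNReal.toReal_ofNat, Real.rpow_two]
      rw [hc]
      set y := Finsupp.linearCombination ℂ (divColumn a) c with hy
      have hym : ∀ m, y m = ∑ n ∈ c.support, c n * divCoeff a m n := fun m => by
        rw [hy, Finsupp.linearCombination_apply, Finsupp.sum, lp.coeFn_sum, Finset.sum_apply]
        refine Finset.sum_congr rfl fun n _ => ?_
        rw [lp.coeFn_smul, Pi.smul_apply, divColumn_apply, smul_eq_mul]
      -- Testing with $x=\overline y$ turns the form into $\sum_F|y_m|^2$, half of which is absorbed
      -- from the right-hand side.
      have h := hφ.norm_sum_divCoeff_le ha F c.support (fun m => conj (y m)) c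
      have h2 : ∑ m ∈ F, ∑ n ∈ c.support, conj (y m) * c n * divCoeff a m n =
          ((∑ m ∈ F, ‖y m‖ ^ 2 : ℝ) : ℂ) := by
        rw [Complex.ofReal_sum]
        refine Finset.sum_congr rfl fun m _ => ?_
        simp only [mul_assoc]
        rw [← Finset.mul_sum, ← hym, Complex.conj_mul', Complex.ofReal_pow]
      rw [h2, Complex.norm_real, Real.norm_of_nonneg (Finset.sum_nonneg fun _ _ => sq_nonneg _)] at h
      simp only [RCLike.norm_conj] at h
      linarith
  -- Coordinate $m$ of $Ne_s$ is $\sum_d a_d(dm)^{-s}$. Continuity of `N` supplies the convergence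
  -- on $\mathbb H_{1/2}$, and the normalized sum does not depend on $m$.
  have hsum : ∀ s ∈ halfPlane (1 / 2), ∀ m : ℕ+,
      HasSum (fun d : ℕ+ => a d * ((d : ℕ) : ℂ) ^ (-s)) (((m : ℕ) : ℂ) ^ s * N (expVec s) m) := by
    intro s hs m
    have h1 := (lp.hasSum_single (by simp) (expVec s)).mapL (coord m ∘L N)
    have h2 : ∀ n, (coord m ∘L N) (lp.single 2 n (expVec s n)) =
        ((n : ℕ) : ℂ) ^ (-s) * divCoeff a m n := fun n => by
      have : (lp.single 2 n (expVec s n) : ell2) =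
          (((n : ℕ) : ℂ) ^ (-s)) • (lp.single 2 n (1 : ℂ) : ell2) := by
        rw [expVec_apply hs, ← lp.single_smul, smul_eq_mul, mul_one]
      rw [this, map_smul, ContinuousLinearMap.comp_apply, hNδ, coord_apply, divColumn_apply,
        smul_eq_mul]
    simp only [h2] at h1
    rw [← (mul_left_injective m).hasSum_iff fun n hn => by
      rw [divCoeff_of_not a hn, mul_zero]] at h1
    have h3 := h1.mul_left (((m : ℕ) : ℂ) ^ s)
    simp only [ContinuousLinearMap.comp_apply, coord_apply, Function.comp_apply,
      divCoeff_mul] at h3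
    have h4 : (fun d : ℕ+ => a d * ((d : ℕ) : ℂ) ^ (-s)) =
        fun d => ((m : ℕ) : ℂ) ^ s * (((d * m : ℕ+) : ℕ) ^ (-s) * a d) := funext fun d => by
      have : ((m : ℕ) : ℂ) ^ s ≠ 0 := by
        rw [Complex.cpow_ne_zero_iff]; exact Or.inl (Nat.cast_ne_zero.2 m.ne_zero)
      rw [PNat.mul_coe, Nat.cast_mul, Complex.natCast_mul_natCast_cpow, Complex.cpow_neg (m : ℂ)]
      field_simp
    rw [h4]
    exact h3
  -- The sum is known to be $\varphi$ only far to the right; holomorphy of $s\mapsto e_s$ carries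
  -- the equality to $\mathbb H_{1/2}$.
  have hone : Set.EqOn (fun s => N (expVec s) 1) φ (halfPlane (1 / 2)) := by
    refine eqOn_halfPlane_of_eqOn (σ := max (A + 1) (1 / 2)) ?_
      (hφ.1.mono (halfPlane_anti (by norm_num))) ?_
    · have := (coord 1 ∘L N).differentiable.comp_differentiableOn sqSummable_univ.differentiableOn
      refine this.congr fun s _ => ?_
      simp
    · intro s hs
      have h1 := hsum s (halfPlane_anti (le_max_right _ _) hs) 1
      have h2 := ha.hasSum s (halfPlane_anti (le_max_left _ _) hs)
      simpa using h1.unique h2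
  refine ⟨N, hN, fun s hs => ?_⟩
  ext m
  have h1 := (hsum s hs m).unique (hsum s hs 1)
  simp only [PNat.one_coe, Nat.cast_one, Complex.one_cpow, one_mul] at h1
  rw [show N (expVec s) 1 = φ s from hone hs] at h1
  rw [lp.coeFn_smul, Pi.smul_apply, expVec_apply hs, smul_eq_mul, ← h1, Complex.cpow_neg]
  have : ((m : ℕ) : ℂ) ^ s ≠ 0 := by
    rw [Complex.cpow_ne_zero_iff]; exact Or.inl (Nat.cast_ne_zero.2 m.ne_zero)
  field_simp

end Contraction

end GaussianMeans

/-! ### Extension of a limit of bounded holomorphic functions -/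

lemma ball_subset_halfPlane {c : ℝ} : Metric.ball (c : ℂ) c ⊆ halfPlane 0 := fun z hz => by
  have h1 : |(z - c).re| < c := (Complex.abs_re_le_norm _).trans_lt (by
    simpa [dist_eq_norm] using hz)
  have h2 := (abs_lt.1 h1).1
  rw [Complex.sub_re, Complex.ofReal_re] at h2
  show 0 < z.re
  linarith

/-- $|s-c|<c$ means $|s|^2<2c\operatorname{Re}s$, true for large $c$. These discs exhaust $\mathbb
H_0$ while their centres lie where convergence is known. -/
lemma exists_mem_ball_of_mem_halfPlane {s : ℂ} (hs : s ∈ halfPlane 0) :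
    ∃ c : ℝ, 1 / 2 < c ∧ s ∈ Metric.ball (c : ℂ) c := by
  have hs0 : 0 < s.re := hs
  have hq : 0 ≤ ‖s‖ ^ 2 / (2 * s.re) := by positivity
  refine ⟨‖s‖ ^ 2 / (2 * s.re) + 1, by linarith, ?_⟩
  set c := ‖s‖ ^ 2 / (2 * s.re) + 1 with hc
  have h1 : ‖s‖ ^ 2 < 2 * s.re * c := by
    rw [hc, mul_add, mul_div_cancel₀ _ (by positivity)]
    linarith
  rw [mem_ball_iff_norm]
  refine lt_of_pow_lt_pow_left₀ 2 (by linarith) ?_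
  have h2 : ‖s - c‖ ^ 2 = ‖s‖ ^ 2 - 2 * s.re * c + c ^ 2 := by
    rw [← Complex.normSq_eq_norm_sq, ← Complex.normSq_eq_norm_sq, Complex.normSq_apply,
      Complex.normSq_apply]
    simp only [Complex.sub_re, Complex.sub_im, Complex.ofReal_re, Complex.ofReal_im]
    ring
  rw [h2]
  linarith

lemma tendstoLocallyUniformlyOn_iteratedDeriv {f : ℕ → ℂ → ℂ} {g : ℂ → ℂ} {U : Set ℂ}
    (hU : IsOpen U) (hf : ∀ k, DifferentiableOn ℂ (f k) U)
    (h : TendstoLocallyUniformlyOn f g Filter.atTop U) (j : ℕ) :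
    TendstoLocallyUniformlyOn (fun k => iteratedDeriv j (f k)) (iteratedDeriv j g)
        Filter.atTop U ∧ ∀ k, DifferentiableOn ℂ (iteratedDeriv j (f k)) U := by
  induction j with
  | zero => simpa only [iteratedDeriv_zero] using ⟨h, hf⟩
  | succ j ih =>
    simp only [iteratedDeriv_succ]
    exact ⟨ih.1.deriv (Filter.Eventually.of_forall ih.2) hU, fun k => (ih.2 k).deriv hU⟩

/-- Functions in the unit ball of `H^∞(ℍ_0)` converging locally uniformly on `ℍ_{1/2}` have a limit
in the unit ball. -/
theorem exists_memUnitBall_of_tendstoLocallyUniformlyOn {f : ℕ → ℂ → ℂ} {g : ℂ → ℂ}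
    (hf : ∀ k, MemUnitBallHInfty (f k))
    (h : TendstoLocallyUniformlyOn f g Filter.atTop (halfPlane (1 / 2))) :
    ∃ Φ, MemUnitBallHInfty Φ ∧ Set.EqOn Φ g (halfPlane (1 / 2)) := by
  -- The plan is to propagate convergence by Taylor series at real centres $c>1/2$: derivatives
  -- converge there, and Cauchy's bounds, uniform in $k$, dominate the series on the whole disc of
  -- radius $c$.
  have hcauchy : ∀ (c r : ℝ), 0 < r → r < c → ∀ k j,
      ‖iteratedDeriv j (f k) c‖ ≤ j.factorial * 1 / r ^ j := fun c r hr hrc k j => by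
    have hsub : Metric.closedBall (c : ℂ) r ⊆ halfPlane 0 :=
      (Metric.closedBall_subset_ball hrc).trans ball_subset_halfPlane
    refine Complex.norm_iteratedDeriv_le_of_forall_mem_sphere_norm_le j hr ?_ fun z hz =>
      (hf k).2 z (hsub (Metric.sphere_subset_closedBall hz))
    exact ((hf k).1.mono (Metric.closure_ball_subset_closedBall.trans hsub)).diffContOnCl
  have hderiv : ∀ c : ℝ, 1 / 2 < c → ∀ j, Filter.Tendsto (fun k => iteratedDeriv j (f k) c)
      Filter.atTop (nhds (iteratedDeriv j g c)) := fun c hc j =>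
    (tendstoLocallyUniformlyOn_iteratedDeriv (halfPlane_isOpen _)
      (fun k => (hf k).1.mono (halfPlane_anti (by norm_num))) h j).1.tendsto_at
        (show 1 / 2 < (c : ℂ).re by simpa using hc)
  have hcauchy' : ∀ (c r : ℝ), 1 / 2 < c → 0 < r → r < c → ∀ j,
      ‖iteratedDeriv j g c‖ ≤ j.factorial * 1 / r ^ j := fun c r hc hr hrc j =>
    le_of_tendsto (hderiv c hc j).norm
      (Filter.Eventually.of_forall fun k => hcauchy c r hr hrc k j)
  let T : ℝ → ℂ → ℂ := fun c s => ∑' j : ℕ,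
    ((j.factorial : ℂ))⁻¹ * ((s - c) ^ j * iteratedDeriv j g c)
  have hterm : ∀ {d z : ℂ} {r ρ : ℝ} (j : ℕ), 0 < r → ‖z‖ ≤ ρ →
      ‖d‖ ≤ j.factorial * 1 / r ^ j →
      ‖((j.factorial : ℂ))⁻¹ * (z ^ j * d)‖ ≤ (ρ / r) ^ j := fun {d z r ρ} j hr hz hd => by
    have hj : (0 : ℝ) < j.factorial := Nat.cast_pos.2 j.factorial_pos
    have hρ : 0 ≤ ρ := (norm_nonneg z).trans hz
    rw [norm_mul, norm_mul, norm_inv, Complex.norm_natCast, norm_pow, div_pow]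
    calc (j.factorial : ℝ)⁻¹ * (‖z‖ ^ j * ‖d‖)
        ≤ (j.factorial : ℝ)⁻¹ * (ρ ^ j * (j.factorial * 1 / r ^ j)) := by gcongr
      _ = ρ ^ j / r ^ j := by field_simp
  have hgeom : ∀ {r ρ : ℝ}, 0 ≤ ρ → ρ < r → Summable fun j : ℕ => (ρ / r) ^ j := fun {r ρ} h0 h1 =>
    summable_geometric_of_lt_one (div_nonneg h0 (h0.trans h1.le)) ((div_lt_one (h0.trans_lt h1)).2 h1)
  have hlim : ∀ c : ℝ, 1 / 2 < c → ∀ s ∈ Metric.ball (c : ℂ) c,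
      Filter.Tendsto (fun k => f k s) Filter.atTop (nhds (T c s)) := by
    intro c hc s hs
    have hs' : ‖s - c‖ < c := by simpa [dist_eq_norm] using hs
    obtain ⟨r, hr1, hr2⟩ := exists_between hs'
    have hr0 : 0 < r := (norm_nonneg _).trans_lt hr1
    have htaylor : ∀ k, f k s = ∑' j : ℕ,
        ((j.factorial : ℂ))⁻¹ * ((s - c) ^ j * iteratedDeriv j (f k) c) := fun k => by
      have := Complex.hasSum_taylorSeries_on_ball ((hf k).1.mono ball_subset_halfPlane) hs
      simpa only [smul_eq_mul] using this.tsum_eq.symm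
    simp only [htaylor]
    exact tendsto_tsum_of_dominated_convergence (hgeom (norm_nonneg _) hr1)
      (fun j => ((hderiv c hc j).const_mul _).const_mul _)
      (Filter.Eventually.of_forall fun k j => hterm j hr0 le_rfl (hcauchy c r hr0 hr2 k j))
  have hTdiff : ∀ c : ℝ, 1 / 2 < c → ∀ s ∈ Metric.ball (c : ℂ) c, DifferentiableAt ℂ (T c) s := by
    intro c hc s hs
    have hs' : ‖s - c‖ < c := by simpa [dist_eq_norm] using hs
    obtain ⟨r, hr1, hr2⟩ := exists_between hs'
    obtain ⟨ρ, hρ1, hρ2⟩ := exists_between hr1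
    have hρ0 : 0 ≤ ρ := (norm_nonneg _).trans hρ1.le
    have hr0 : 0 < r := (norm_nonneg _).trans_lt hr1
    have hd : DifferentiableOn ℂ (T c) (Metric.ball (c : ℂ) ρ) := by
      refine Complex.differentiableOn_tsum_of_summable_norm (hgeom hρ0 hρ2) (fun j => ?_)
        Metric.isOpen_ball fun j w hw => ?_
      · fun_prop
      · refine hterm j hr0 ?_ (hcauchy' c r hc hr0 hr2 j)
        rw [← dist_eq_norm]
        exact (Metric.mem_ball.1 hw).le
    exact hd.differentiableAt (Metric.isOpen_ball.mem_nhds (by simpa [dist_eq_norm] using hρ1))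
  -- As a pointwise limit, `Φ` agrees with every local Taylor sum `T c`, so no compatibility between
  -- discs has to be checked.
  let Φ : ℂ → ℂ := fun s => Filter.atTop.limUnder fun k => f k s
  have hΦ : ∀ c : ℝ, 1 / 2 < c → Set.EqOn Φ (T c) (Metric.ball (c : ℂ) c) := fun c hc s hs =>
    (hlim c hc s hs).limUnder_eq
  refine ⟨Φ, ⟨fun s hs => ?_, fun s hs => ?_⟩, fun s hs => (h.tendsto_at hs).limUnder_eq⟩
  · obtain ⟨c, hc, hsc⟩ := exists_mem_ball_of_mem_halfPlane hs
    exact ((hTdiff c hc s hsc).congr_of_eventuallyEq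
      ((hΦ c hc).eventuallyEq_of_mem (Metric.isOpen_ball.mem_nhds hsc))).differentiableWithinAt
  · obtain ⟨c, hc, hsc⟩ := exists_mem_ball_of_mem_halfPlane hs
    rw [hΦ c hc hsc]
    exact le_of_tendsto (hlim c hc s hsc).norm
      (Filter.Eventually.of_forall fun k => (hf k).2 s hs)

/-! ### Contractive multipliers extend to `ℍ_0` -/

/-- The operator `y ↦ (y (d * m))_d`. -/
def dilate (m : ℕ+) : ell2 →L[ℂ] ell2 :=
  LinearMap.mkContinuous
    { toFun := fun y => ⟨fun d => y (d * m), by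
        refine (memℓp_gen_iff (by simp)).2 ?_
        have h := (ell2_hasSum_sq y).summable.comp_injective (mul_left_injective m)
        simpa [Function.comp_def] using h⟩
      map_add' := fun _ _ => rfl
      map_smul' := fun _ _ => rfl } 1 fun y => by
    rw [one_mul]
    refine le_of_pow_le_pow_left₀ two_ne_zero (norm_nonneg _) ?_
    rw [← (ell2_hasSum_sq _).tsum_eq, ← (ell2_hasSum_sq y).tsum_eq]
    exact (ell2_hasSum_sq _).summable.tsum_le_tsum_of_inj _ (mul_left_injective m)
      (fun _ _ => sq_nonneg _) (fun _ => le_rfl) (ell2_hasSum_sq y).summable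

lemma dilate_apply (m : ℕ+) (y : ell2) (d : ℕ+) : dilate m y d = y (d * m) := rfl

/-- The positive integers all of whose prime factors are less than `k`. -/
def smoothSet (k : ℕ) : Set ℕ+ := {n | (n : ℕ) ∈ Nat.smoothNumbers k}

/-- This multiplicativity makes the truncated vector $(n^{-s})_{n\in S}$ an eigenvector of every
`dilate m`. -/
lemma mul_mem_smoothSet {k : ℕ} {m n : ℕ+} :
    m * n ∈ smoothSet k ↔ m ∈ smoothSet k ∧ n ∈ smoothSet k := by
  simp only [smoothSet, Set.mem_ofPred_eq, PNat.mul_coe]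
  exact ⟨fun h => ⟨Nat.mem_smoothNumbers_of_dvd h (Dvd.intro _ rfl),
    Nat.mem_smoothNumbers_of_dvd h (Dvd.intro_left _ rfl)⟩,
    fun h => Nat.mul_mem_smoothNumbers h.1 h.2⟩

/-- An Euler product over finitely many primes converges absolutely for every $\sigma>0$, beyond the
barrier $1/2$. -/
lemma sqSummable_smoothSet (k : ℕ) : SqSummable (smoothSet k) 0 := by
  intro σ hσ
  let f : ℕ →* ℝ :=
    { toFun := fun n => (n : ℝ) ^ (-(2 * σ))
      map_one' := by simp
      map_mul' := fun m n => by
        rw [Nat.cast_mul, Real.mul_rpow (Nat.cast_nonneg _) (Nat.cast_nonneg _)] }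
  have hf := (EulerProduct.summable_and_hasSum_smoothNumbers_prod_primesBelow_geometric (f := f)
    (fun {p} hp => by
      change ‖(p : ℝ) ^ (-(2 * σ))‖ < 1
      rw [Real.norm_of_nonneg (by positivity)]
      exact Real.rpow_lt_one_of_one_lt_of_neg (by exact_mod_cast hp.one_lt) (by linarith)) k).1
  have h1 : Summable fun n : smoothSet k => ‖f (n : ℕ+)‖ :=
    hf.comp_injective (i := fun n : smoothSet k => (⟨(n : ℕ+), n.2⟩ : Nat.smoothNumbers k))
      fun m n h => Subtype.ext (PNat.coe_injective (Subtype.mk.inj h))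
  have h2 := (summable_subtype_iff_indicator (f := fun n : ℕ+ => ‖f n‖) (s := smoothSet k)).1 h1
  refine h2.congr fun n => ?_
  by_cases hn : n ∈ smoothSet k
  · rw [Set.indicator_of_mem hn, dirCoeff, Set.indicator_of_mem hn, norm_pnat_cpow,
      ← Real.rpow_natCast, ← Real.rpow_mul (by simp)]
    change ‖((n : ℕ) : ℝ) ^ (-(2 * σ))‖ = _
    rw [Real.norm_of_nonneg (by positivity)]
    congr 1
    simp
    ring
  · simp [dirCoeff, hn]

/-- A contraction of `ℓ²` with eigenvectors `(n ^ (-s))_n`, `Re s > 1/2`, has an eigenvalue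
function extending to the unit ball of `H^∞(ℍ_0)`, with a Dirichlet series. -/
theorem exists_memUnitBall_of_contraction {φ : ℂ → ℂ} (N : ell2 →L[ℂ] ell2) (hN : ‖N‖ ≤ 1)
    (h : ∀ s ∈ halfPlane (1 / 2), N (expVec s) = φ s • expVec s) :
    ∃ Φ, MemUnitBallHInfty Φ ∧ IsDirichletSeries Φ ∧ Set.EqOn Φ φ (halfPlane (1 / 2)) := by
  -- `dilate m` has eigenvector $e_s$ with eigenvalue $m^{-s}$, so the two functionals agree on a
  -- total set. The first coordinate functional thus determines `N`.
  have hcomm : ∀ m y, N y m = N (dilate m y) 1 := by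
    intro m y
    have hop : coord m ∘L N = coord 1 ∘L N ∘L dilate m := by
      refine ContinuousLinearMap.ext_on dense_span_expVec ?_
      rintro _ ⟨⟨s, hs⟩, rfl⟩
      have hd : dilate m (expVec s) = (((m : ℕ) : ℂ) ^ (-s)) • expVec s := by
        ext d
        rw [dilate_apply, lp.coeFn_smul, Pi.smul_apply, expVec_apply hs, expVec_apply hs,
          PNat.mul_coe, Nat.cast_mul, Complex.natCast_mul_natCast_cpow, smul_eq_mul, mul_comm]
      simp only [ContinuousLinearMap.comp_apply, coord_apply, hd, map_smul, h s hs,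
        expVec_apply hs, smul_eq_mul]
      simp [mul_comm]
    simpa using DFunLike.congr_fun hop y
  let f : ℕ → ℂ → ℂ := fun k s => (coord 1 ∘L N) (dirVec (smoothSet k) s)
  have hf : ∀ k, MemUnitBallHInfty (f k) := by
    intro k
    refine ⟨(coord 1 ∘L N).differentiable.comp_differentiableOn
      (sqSummable_smoothSet k).differentiableOn, fun s hs => ?_⟩
    have happ := (sqSummable_smoothSet k).dirVec_apply hs
    -- By `hcomm` the truncated vector inherits the eigenvector property on all of $\mathbb H_0$,
    -- and $\|N\|\le1$ then bounds the eigenvalue by $1$.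
    have heig : N (dirVec (smoothSet k) s) = f k s • dirVec (smoothSet k) s := by
      ext m
      have hd : dilate m (dirVec (smoothSet k) s) =
          (dirCoeff (smoothSet k) s m) • dirVec (smoothSet k) s := by
        ext d
        rw [dilate_apply, lp.coeFn_smul, Pi.smul_apply, happ, happ, smul_eq_mul]
        by_cases hm : m ∈ smoothSet k <;> by_cases hd : d ∈ smoothSet k <;>
          simp [dirCoeff, mul_mem_smoothSet, hm, hd, Complex.natCast_mul_natCast_cpow, mul_comm]
      rw [hcomm, hd, map_smul, lp.coeFn_smul, lp.coeFn_smul, Pi.smul_apply, Pi.smul_apply, happ,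
        smul_eq_mul, smul_eq_mul, mul_comm]
      simp [f]
    have hpos : 0 < ‖dirVec (smoothSet k) s‖ := by
      have h1 : (1 : ℕ+) ∈ smoothSet k := by
        exact Nat.mem_smoothNumbers.2 ⟨one_ne_zero, by simp⟩
      have := norm_apply_le_ell2 (dirVec (smoothSet k) s) 1
      rw [happ, dirCoeff, Set.indicator_of_mem h1] at this
      simp at this
      linarith
    have := N.le_of_opNorm_le hN (dirVec (smoothSet k) s)
    rw [heig, norm_smul] at this
    exact le_of_mul_le_mul_right this hpos
  have hone : ∀ s ∈ halfPlane (1 / 2), (coord 1 ∘L N) (expVec s) = φ s := fun s hs => by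
    rw [ContinuousLinearMap.comp_apply, h s hs, map_smul, coord_apply, expVec_apply hs]
    simp
  have hlim : TendstoLocallyUniformlyOn f φ Filter.atTop (halfPlane (1 / 2)) := by
    have h1 := sqSummable_univ.tendstoLocallyUniformlyOn (l := Filter.atTop) (A := smoothSet)
      fun n _ => (Filter.eventually_gt_atTop (n : ℕ)).mono fun k hk =>
        Nat.mem_smoothNumbers_of_lt n.pos hk
    simp only [Set.univ_inter] at h1
    have h2 := (coord 1 ∘L N).uniformContinuous.comp_tendstoLocallyUniformlyOn h1
    exact h2.congr_right fun s hs => hone s hs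
  obtain ⟨Φ, hΦ, hΦφ⟩ := exists_memUnitBall_of_tendstoLocallyUniformlyOn hf hlim
  -- The $n$-th Dirichlet coefficient is the first coordinate of $N\delta_n$, by expanding $e_s=\sum
  -- n^{-s}\delta_n$. The value at $n=0$ is never summed.
  refine ⟨Φ, hΦ, ⟨fun n => if hn : 0 < n then N (lp.single 2 ⟨n, hn⟩ (1 : ℂ)) 1 else 0, 1 / 2,
    by norm_num, fun s hs => ?_⟩, hΦφ⟩
  have h1 := (lp.hasSum_single (by simp) (expVec s)).mapL (coord 1 ∘L N)
  rw [hone s hs, ← hΦφ hs] at h1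
  have h2 : ∀ n : ℕ+, (coord 1 ∘L N) (lp.single 2 n (expVec s n)) =
      (if hn : 0 < (n : ℕ) then N (lp.single 2 ⟨n, hn⟩ (1 : ℂ)) 1 else 0) *
        ((n : ℕ) : ℂ) ^ (-s) := fun n => by
    have : (lp.single 2 n (expVec s n) : ell2) =
        (((n : ℕ) : ℂ) ^ (-s)) • (lp.single 2 n (1 : ℂ) : ell2) := by
      rw [expVec_apply hs, ← lp.single_smul, smul_eq_mul, mul_one]
    rw [this, map_smul, dif_pos n.pos, smul_eq_mul, mul_comm, ContinuousLinearMap.comp_apply,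
      coord_apply]
    rfl
  simp only [h2] at h1
  have h3 := (hasSum_pnat_iff (f := fun n : ℕ => (if hn : 0 < n then
    N (lp.single 2 ⟨n, hn⟩ (1 : ℂ)) 1 else 0) * (n : ℂ) ^ (-s))).1 h1
  refine h3.tendsto_sum_nat.congr fun M => ?_
  rw [Finset.range_eq_Ico, Finset.sum_Ico_add' (fun n : ℕ => (if hn : 0 < n then
    N (lp.single 2 ⟨n, hn⟩ (1 : ℂ)) 1 else 0) * (n : ℂ) ^ (-s)) 0 M 1]
  rfl

/-! ### From realizations to contractions and back -/

/-- A linear map isometric on a subspace preserves inner products there. -/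
lemma inner_map_eq_of_norm_map_eq {E F : Type*} [NormedAddCommGroup E] [InnerProductSpace ℂ E]
    [NormedAddCommGroup F] [InnerProductSpace ℂ F] (V : E →L[ℂ] F) (M : Submodule ℂ E)
    (h : ∀ x ∈ M, ‖V x‖ = ‖x‖) {x y : E} (hx : x ∈ M) (hy : y ∈ M) :
    ⟪V x, V y⟫_ℂ = ⟪x, y⟫_ℂ := by
  let V' : M →ₗᵢ[ℂ] F := ⟨V.toLinearMap ∘ₗ M.subtype, fun x => h x x.2⟩
  exact V'.inner_map_map ⟨x, hx⟩ ⟨y, hy⟩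

section Realization

variable {φ : ℂ → ℂ} {K : Type*} [NormedAddCommGroup K] [InnerProductSpace ℂ K]

/-- The Gram matrix of `ψ` in a realization of `φ`. -/
lemma Realizes.inner_eq {ψ : ℂ → K} {a : ℂ} {β : HilbertTensor HTwo K} {γ : HilbertTensor HMu K}
    {D : HilbertTensor HTwo K →L[ℂ] HilbertTensor HMu K} (h : Realizes φ K ψ a β γ D)
    (u s : halfPlane (1 / 2)) :
    ⟪ψ u, ψ s⟫_ℂ = szegoKernel s u * (1 - conj (φ u) * φ s) := by
  let X : halfPlane (1 / 2) → WithLp 2 (ℂ × HilbertTensor HTwo K) := fun s =>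
    WithLp.toLp 2 ((1 : ℂ), tensor (szegoFun (conjPt s)) (ψ s))
  let Y : halfPlane (1 / 2) → WithLp 2 (ℂ × HilbertTensor HMu K) := fun s =>
    WithLp.toLp 2 (φ s, tensor (muFun (conjPt s)) (ψ s))
  -- The resolvent sends $\gamma$ back to $\varkappa_{\overline s}\otimes\psi(s)$, so the formula
  -- for $\varphi(s)$ is the scalar component of $V$.
  have hV : ∀ s, blockOp a β γ D (X s) = Y s := fun s => by
    obtain ⟨T, hT, hinv, hφ⟩ := h.formula s
    have h1 : (ampliation K T - D) (tensor (szegoFun (conjPt s)) (ψ s)) = γ := by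
      rw [sub_apply, ampliation_tensor, hT, h.map_tensor]
      abel
    have h2 : (ampliation K T - D).inverse γ = tensor (szegoFun (conjPt s)) (ψ s) := by
      rw [← h1, hinv.inverse_apply_self]
    rw [h2] at hφ
    simp only [X, Y]
    rw [blockOp_toLp, h.map_tensor, mul_one, ← hφ, one_smul, add_sub_cancel]
  let M := (Submodule.span ℂ (Set.range X)).topologicalClosure
  have hX : ∀ s, X s ∈ M := fun s =>
    Submodule.le_topologicalClosure _ (Submodule.subset_span ⟨s, rfl⟩)
  have hin : ⟪Y u, Y s⟫_ℂ = ⟪X u, X s⟫_ℂ := by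
    rw [← hV, ← hV]
    exact inner_map_eq_of_norm_map_eq (blockOp a β γ D) M h.isometric (hX u) (hX s)
  simp only [X, Y, WithLp.prod_inner_apply, inner_tensor, inner_szegoFun, inner_muFun,
    RCLike.inner_apply', map_one, one_mul] at hin
  have hk := szegoKernel_mul_muKernel_sub s u
  linear_combination (-⟪ψ u, ψ s⟫_ℂ) * hk + szegoKernel s u * hin

/-- The Gram identity gives $\|\sum c_se_s\|^2=\|\sum c_s\varphi(s)e_s\|^2+\|\sum c_s\psi(s)\|^2$,
so $e_s\mapsto\varphi(s)e_s$ is contractive. -/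
theorem HasNetworkRealization.exists_memUnitBall (h : HasNetworkRealization.{u} φ) :
    ∃ Φ, MemUnitBallHInfty Φ ∧ IsDirichletSeries Φ ∧ Set.EqOn Φ φ (halfPlane (1 / 2)) := by
  obtain ⟨K, _, _, _, ψ, a, β, γ, D, hR⟩ := h
  obtain ⟨N, hN, hNe⟩ := exists_contraction_of_norm_le
    (fun s : halfPlane (1 / 2) => expVec s) (fun s : halfPlane (1 / 2) => φ s • expVec s) fun c => by
      have key : ⟪Finsupp.linearCombination ℂ (fun s : halfPlane (1 / 2) => expVec s) c,
          Finsupp.linearCombination ℂ (fun s : halfPlane (1 / 2) => expVec s) c⟫_ℂ =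
          ⟪Finsupp.linearCombination ℂ (fun s : halfPlane (1 / 2) => φ s • expVec s) c,
            Finsupp.linearCombination ℂ (fun s : halfPlane (1 / 2) => φ s • expVec s) c⟫_ℂ +
          ⟪Finsupp.linearCombination ℂ (fun s : halfPlane (1 / 2) => ψ s) c,
            Finsupp.linearCombination ℂ (fun s : halfPlane (1 / 2) => ψ s) c⟫_ℂ := by
        simp only [Finsupp.linearCombination_apply, Finsupp.sum, sum_inner, inner_sum,
          inner_smul_left, inner_smul_right, inner_expVec, hR.inner_eq, Finset.mul_sum,
          ← Finset.sum_add_distrib]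
        refine Finset.sum_congr rfl fun u _ => Finset.sum_congr rfl fun s _ => ?_
        ring
      have hre := congrArg Complex.re key
      simp only [← RCLike.re_eq_complex_re, map_add, inner_self_eq_norm_sq] at hre
      refine le_of_pow_le_pow_left₀ two_ne_zero (norm_nonneg _) ?_
      rw [hre]
      exact le_add_of_nonneg_right (sq_nonneg _)
  exact exists_memUnitBall_of_contraction N hN fun s hs => hNe ⟨s, hs⟩

/-- A family with the Gram matrix `ζ(s + ū) (1 - φ(s) conj φ(u))` yields a realization of `φ`. -/
theorem exists_realizes_of_inner_eq [CompleteSpace K] {ψ : ℂ → K}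
    (hψ : DifferentiableOn ℂ ψ (halfPlane (1 / 2)))
    (h : ∀ u s : halfPlane (1 / 2),
      ⟪ψ u, ψ s⟫_ℂ = szegoKernel s u * (1 - conj (φ u) * φ s)) :
    ∃ a β γ D, Realizes φ K ψ a β γ D := by
  let X : halfPlane (1 / 2) → WithLp 2 (ℂ × HilbertTensor HTwo K) := fun s =>
    WithLp.toLp 2 ((1 : ℂ), tensor (szegoFun (conjPt s)) (ψ s))
  let Y : halfPlane (1 / 2) → WithLp 2 (ℂ × HilbertTensor HMu K) := fun s =>
    WithLp.toLp 2 (φ s, tensor (muFun (conjPt s)) (ψ s))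
  have hin : ∀ u s, ⟪X u, X s⟫_ℂ = ⟪Y u, Y s⟫_ℂ := fun u s => by
    simp only [X, Y, WithLp.prod_inner_apply, inner_tensor, inner_szegoFun, inner_muFun,
      RCLike.inner_apply', map_one, one_mul]
    have hk := szegoKernel_mul_muKernel_sub s u
    rw [h]
    linear_combination (conj (φ u) * φ s - 1) * hk
  obtain ⟨V, hV, hVX⟩ := exists_contraction_of_norm_le X Y fun c =>
    (norm_linearCombination_eq_of_inner_eq hin c).le
  obtain ⟨a, β, γ, D, rfl⟩ := exists_blockOp_eq V
  have hcomp : ∀ s : halfPlane (1 / 2),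
      a + ⟪β, tensor (szegoFun (conjPt s)) (ψ s)⟫_ℂ = φ s ∧
      γ + D (tensor (szegoFun (conjPt s)) (ψ s)) = tensor (muFun (conjPt s)) (ψ s) := fun s => by
    have h1 := hVX s
    simp only [X, Y] at h1
    rw [blockOp_toLp, mul_one, one_smul] at h1
    exact Prod.ext_iff.1 (congrArg WithLp.ofLp h1)
  have hD : ∀ s : halfPlane (1 / 2), D (tensor (szegoFun (conjPt s)) (ψ s)) =
      tensor (muFun (conjPt s)) (ψ s) - γ := fun s => eq_sub_of_add_eq' (hcomp s).2
  refine ⟨a, β, γ, D, hψ, hV, fun x hx => ?_, hD, fun s => ?_⟩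
  -- `V` is isometric on finite combinations by equality of Gram matrices, and this is a closed
  -- condition.
  · have hclosed : IsClosed {x | ‖blockOp a β γ D x‖ = ‖x‖} :=
      isClosed_eq (by fun_prop) (by fun_prop)
    refine closure_minimal (fun y hy => ?_) hclosed hx
    rw [SetLike.mem_coe, ← Finsupp.range_linearCombination] at hy
    obtain ⟨c, rfl⟩ := hy
    change ‖blockOp a β γ D (Finsupp.linearCombination ℂ X c)‖ =
      ‖Finsupp.linearCombination ℂ X c‖
    rw [← norm_linearCombination_eq_of_inner_eq hin c]
    congr 1
    simp only [Finsupp.linearCombination_apply, Finsupp.sum, map_sum, map_smul, hVX]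
  · obtain ⟨T, hT, hTs⟩ := exists_equiv_szegoFun_muFun s
    have hinv := isInvertible_ampliation_sub (G := K) T hTs D
      ((norm_corner_le_norm_blockOp a β γ D).trans hV)
    refine ⟨T, hT, hinv, ?_⟩
    have h1 : (ampliation K (T : HTwo →L[ℂ] HMu) - D) (tensor (szegoFun (conjPt s)) (ψ s)) = γ := by
      rw [sub_apply, ampliation_tensor, hD]
      change tensor (T (szegoFun (conjPt s))) (ψ s) - _ = _
      rw [hT]
      abel
    have h2 : (ampliation K (T : HTwo →L[ℂ] HMu) - D).inverse γ =
        tensor (szegoFun (conjPt s)) (ψ s) := by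
      conv_lhs => rw [← h1]
      rw [hinv.inverse_apply_self]
    rw [h2, (hcomp s).1]

end Realization

/-! ### Realizations built from the defect operator -/

/-- `ℓ²` embeds isometrically into a Hilbert space of any universe. -/
lemma exists_linearIsometry_ell2 :
    Nonempty (ell2 →ₗᵢ[ℂ] lp (fun _ : ULift.{u} ℕ+ => ℂ) 2) := by
  let J : ell2 →ₗ[ℂ] lp (fun _ : ULift.{u} ℕ+ => ℂ) 2 :=
    { toFun := fun y => ⟨fun d => y d.down, by
        refine (memℓp_gen_iff (by simp)).2 ?_
        have h := (ell2_hasSum_sq y).summable.comp_injective ULift.down_injective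
        simpa [Function.comp_def] using h⟩
      map_add' := fun _ _ => rfl
      map_smul' := fun _ _ => rfl }
  refine ⟨⟨J, fun y => ?_⟩⟩
  have h1 := lp.hasSum_norm (p := 2) (by simp) (J y)
  have h2 := Equiv.ulift.{u}.hasSum_iff.2 (ell2_hasSum_sq y)
  simp only [ENNReal.toReal_ofNat, Real.rpow_two] at h1
  have h3 : ‖J y‖ ^ 2 = ‖y‖ ^ 2 := h1.unique h2
  exact (pow_left_inj₀ (norm_nonneg _) (norm_nonneg _) two_ne_zero).1 h3

/-- The defect operator `(1 - N* N)^{1/2}` of a contraction. -/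
lemma exists_defect {E : Type*} [NormedAddCommGroup E] [InnerProductSpace ℂ E] [CompleteSpace E]
    (N : E →L[ℂ] E) (hN : ‖N‖ ≤ 1) :
    ∃ R : E →L[ℂ] E, ∀ x y, ⟪R x, R y⟫_ℂ = ⟪x, y⟫_ℂ - ⟪N x, N y⟫_ℂ := by
  -- In a C*-algebra a positive element of norm at most $1$ lies below the identity.
  have hpos : 0 ≤ 1 - star N * N := by
    rw [sub_nonneg, ← CStarAlgebra.norm_le_one_iff_of_nonneg _ (star_mul_self_nonneg N),
      CStarRing.norm_star_mul_self]
    exact mul_le_one₀ hN (norm_nonneg _) hN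
  refine ⟨CFC.sqrt (1 - star N * N), fun x y => ?_⟩
  have hsa : star (CFC.sqrt (1 - star N * N)) = CFC.sqrt (1 - star N * N) :=
    (CFC.sqrt_nonneg _).isSelfAdjoint
  have h1 : ⟪CFC.sqrt (1 - star N * N) x, CFC.sqrt (1 - star N * N) y⟫_ℂ =
      ⟪x, (CFC.sqrt (1 - star N * N) * CFC.sqrt (1 - star N * N)) y⟫_ℂ := by
    rw [mul_apply_eq_comp]
    conv_rhs => rw [← hsa, ContinuousLinearMap.star_eq_adjoint,
      ContinuousLinearMap.adjoint_inner_right, ← ContinuousLinearMap.star_eq_adjoint, hsa]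
  rw [h1, CFC.sqrt_mul_sqrt_self _ hpos, sub_apply, inner_sub_right, one_apply_eq_self,
    mul_apply_eq_comp, ContinuousLinearMap.star_eq_adjoint,
    ContinuousLinearMap.adjoint_inner_right]

/-- With $\psi(s)=(1-N^*N)^{1/2}e_s$, the eigenvector relation turns $\langle e_s,e_u\rangle-\langle
Ne_s,Ne_u\rangle$ into the required Gram kernel. The isometry `J` only moves `ψ` to a space in the
prescribed universe. -/
theorem MemUnitBallHInfty.hasNetworkRealization {Φ φ : ℂ → ℂ} (hΦ : MemUnitBallHInfty Φ)
    (hD : IsDirichletSeries Φ) (h : Set.EqOn Φ φ (halfPlane (1 / 2))) :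
    HasNetworkRealization.{u} φ := by
  obtain ⟨N, hN, hNe⟩ := hΦ.exists_contraction hD
  obtain ⟨R, hR⟩ := exists_defect N hN
  obtain ⟨J⟩ := exists_linearIsometry_ell2.{u}
  refine ⟨_, _, _, inferInstance, fun s => J (R (expVec s)), exists_realizes_of_inner_eq ?_ ?_⟩
  · exact (J.toContinuousLinearMap ∘L R).differentiable.comp_differentiableOn
      sqSummable_univ.differentiableOn
  · intro u s
    rw [J.inner_map_map, hR, hNe u u.2, hNe s s.2, h u.2, h s.2, inner_smul_left,
      inner_smul_right, inner_expVec]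
    ring

end NetworkRealization

end

theorem theorem1p3 (φ : ℂ → ℂ) :
    ((∃ Φ : ℂ → ℂ, NetworkRealization.MemUnitBallHInfty Φ ∧
        NetworkRealization.IsDirichletSeries Φ ∧
        Set.EqOn Φ φ (NetworkRealization.halfPlane (1 / 2))) ↔
      NetworkRealization.HasNetworkRealization.{u} φ) ∧
    (DifferentiableOn ℂ φ (NetworkRealization.halfPlane 0) →
      ((NetworkRealization.MemUnitBallHInfty φ ∧ NetworkRealization.IsDirichletSeries φ) ↔
        NetworkRealization.HasNetworkRealization.{u} φ)) := by
  refine ⟨⟨fun ⟨Φ, h1, h2, h3⟩ => h1.hasNetworkRealization h2 h3, fun h => h.exists_memUnitBall⟩,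
    fun hφ => ⟨fun h => h.1.hasNetworkRealization h.2 fun _ _ => rfl, fun h => ?_⟩⟩
  obtain ⟨Φ, hΦ, ⟨c, σ, hσ, hc⟩, heq⟩ := h.exists_memUnitBall
  -- Holomorphy of `φ` on $\mathbb H_0$ lets the identity theorem equate it with the extension `Φ`
  -- there. The condition $\sigma\ge0$ then places the half-plane of convergence inside $\mathbb
  -- H_0$.
  have heq' := NetworkRealization.eqOn_halfPlane_of_eqOn hΦ.1 hφ heq
  refine ⟨⟨hφ, fun s hs => ?_⟩, c, σ, hσ, fun s hs => ?_⟩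
  · rw [← heq' hs]
    exact hΦ.2 s hs
  · rw [← heq' (NetworkRealization.halfPlane_anti hσ hs)]
    exact hc s hs
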